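/- Conventions. Let $S$ be a semigroup and let $S^1$ be $S$ with an identity adjoined if necessary. For $x,y\in S$ and $w_1,w_2,\dots\in S^1$ put $\lambda_0=x$, $\rho_0=y$, $\lambda_{n+1}=\lambda_n w_{n+1}\rho_n$, $\rho_{n+1}=\rho_n w_{n+1}\lambda_n$. The semigroup $S$ is \emph{nilpotent} (in the sense of Mal'cev) if for some $n\ge 1$ one has $\lambda_n=\rho_n$ for all $x,y\in S$ and all $w_1,\dots,w_n\in S^1$. The \emph{upper non-nilpotent graph} $\mathcal N_S$ has vertex set $S$, and distinct $x,y$ are adjacent if the subsemigroup $\langle x,y\rangle$ is not nilpotent. The empty set counts as an ideal, and $S/\emptyset=S$; $S/I$ is the Rees factor semigroup, and $(S/I)^0$ is $S/I$ if $I\neq\emptyset$ and $S$ with a zero adjoined if $I=\emptyset$. Elements of $S\setminus I$ are identified with the non-zero elements of $(S/I)^0$. $S$ is \emph{pseudo-nilpotent} if, whenever $x,y\in S$, $w_1,\dots,w_m\in S^1$, $0\le t<m$, $\lambda_t\ne\rho_t$, $(\lambda_t,\rho_t)=(\lambda_m,\rho_m)$ and $I$ is an ideal (possibly empty) of $T=\langle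 x,y,w_1,\dots,w_m\rangle$ with $\lambda_m,\rho_m\notin I$, the elements $\lambda_i$ and $\rho_i$ are adjacent in $\mathcal N_{T/I}$ for every $0\le i\le m$. Let $S$ be finite with principal series $S=S_1\supset S_2\supset\dots\supset S_m\supset S_{m+1}=\emptyset$ (each $S_i$ is an ideal and there is no ideal strictly between $S_{i+1}$ and $S_i$). Let $F_i$ be the set of all $s\in S\setminus S_i$ such that $st\notin S_{i+1}$ or $ts\notin S_{i+1}$ for some $t\in S_i$. The set $S_i\setminus S_{i+1}$ is a \emph{root} if $S_i/S_{i+1}$ is not nilpotent and no element of $S_i\setminus S_{i+1}$ is adjacent in $\mathcal N_S$ to an element of $S_{i+1}$; its \emph{stem} is then the union $S^{(i)}$ of all $S_j\setminus S_{j+1}$ with $j\le i$ and $S_j\setminus S_{j+1}\subseteq F_i\cup(S_i\setminus S_{i+1})$. A \emph{connection} between two distinct stems $S^{(i)}$ and $S^{(k)}$ is a set $S_j\setminus S_{j+1}\subseteq S^{(i)}\cap S^{(k)}$. For a root $S_i\setminus S_{i+1}$ write $(S_i/S_{i+1})^0=\mathcal M^0(G,I,\Lambda;P)$, a regular Rees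 matrix semigroup over a group $G$; the \emph{pseudo-nilpotent homomorphism} $\Phi_i:(S/S_{i+1})^0\to(I\times\Lambda)^0$ sends $a\in F_i\cup(S_i\setminus S_{i+1})$ to the pair $(e,f)$ such that $a$ is adjacent in $\mathcal N_{(S/S_{i+1})^0}$ to no $(g;e,f)$, $g\in G$, and sends all other elements to the zero. Its fibres are the \emph{pseudo-nilpotent classes} of $\Phi_i$. $S$ is \emph{strong pseudo-nilpotent} if it is pseudo-nilpotent and (H1) every connection $S_j\setminus S_{j+1}$ between two distinct stems $S^{(i)}$ and $S^{(k)}$ intersects two different pseudo-nilpotent classes of $\Phi_i$ and two different pseudo-nilpotent classes of $\Phi_k$; (H2) if $i<j$ and some element of $S_i\setminus S_{i+1}$ is adjacent in $\mathcal N_S$ to some element of $S_j\setminus S_{j+1}$, then $S_i\setminus S_{i+1}\subseteq F_j$. Statement. Let $S$ be a strong pseudo-nilpotent finite semigroup. Then $S$ has a largest nilpotent ideal $K$ (possibly empty), and, with $K_a=\{s\in S\mid as\notin K\}$, the connected components of $\mathcal N_S$ with more than one element are exactly the maximal elements, with respect to inclusion, of the set $\{K_a\mid a\in S\setminus K\}$.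 -/

import Mathlib

universe u

namespace PseudoNilpotent

/-! ### Mal'cev nilpotency and the upper non-nilpotent graph -/

/-- The product `a z b`, where `z` ranges over `S¹`. Here `S¹` is represented by `Option S`, with
`none` acting as an identity element. (If `S` already has an identity element `e`, then `none` and
`some e` give the same products.) -/
def mid {S : Type u} [Mul S] (a : S) (z : Option S) (b : S) : S :=
  match z with
  | none => a * b
  | some w => a * w * b

/-- The pair `(λₙ(x, y, z₁, …, zₙ), ρₙ(x, y, z₁, …, zₙ))`; the parameter `zₙ₊₁` is `z n`. -/
def malcev {S : Type u} [Mul S] (x y : S) (z : ℕ → Option S) : ℕ → S × S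
  | 0 => (x, y)
  | n + 1 =>
    (mid (malcev x y z n).1 (z n) (malcev x y z n).2,
      mid (malcev x y z n).2 (z n) (malcev x y z n).1)

/-- Nilpotency of a semigroup in the sense of Mal'cev. -/
def IsNilp (S : Type u) [Mul S] : Prop :=
  ∃ n : ℕ, 1 ≤ n ∧ ∀ (a b : S) (c : ℕ → Option S), (malcev a b c n).1 = (malcev a b c n).2

/-- The upper non-nilpotent graph: `x` and `y` are adjacent if the subsemigroup `⟨x, y⟩` is not
nilpotent. -/
def nonNilGraph (S : Type u) [Mul S] : SimpleGraph S where
  Adj x y := x ≠ y ∧ ¬ IsNilp (Subsemigroup.closure ({x, y} : Set S))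
  symm := ⟨fun x y h => ⟨h.1.symm, by rw [Set.pair_comm]; exact h.2⟩⟩
  loopless := ⟨fun _ h => h.1 rfl⟩

/-! ### Ideals and Rees quotients -/

/-- A (two-sided, possibly empty) ideal of a semigroup. -/
@[ext]
structure SIdeal (S : Type u) [Mul S] where
  carrier : Set S
  mul_mem_left : ∀ (s : S) {a : S}, a ∈ carrier → s * a ∈ carrier
  mul_mem_right : ∀ (s : S) {a : S}, a ∈ carrier → a * s ∈ carrier

namespace SIdeal

variable {S : Type u} [Mul S]

instance : SetLike (SIdeal S) S where
  coe := carrier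
  coe_injective I J h := by
    cases I; cases J; congr

/-- An ideal as a subsemigroup. -/
def toSub (I : SIdeal S) : Subsemigroup S where
  carrier := I
  mul_mem' {a _} _ hb := I.mul_mem_left a hb

/-- The ideal `I ∩ T` of a subsemigroup `T`. -/
def restrict (I : SIdeal S) (T : Subsemigroup S) : SIdeal T where
  carrier := {a | (a : S) ∈ I}
  mul_mem_left s _ ha := I.mul_mem_left (s : S) ha
  mul_mem_right s _ ha := I.mul_mem_right (s : S) ha

/-- The Rees congruence: all elements of `I` are identified (nothing happens if `I = ∅`). -/
def con (I : SIdeal S) : Con S where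
  r a b := a = b ∨ (a ∈ I ∧ b ∈ I)
  iseqv :=
    { refl := fun _ => Or.inl rfl
      symm := by
        rintro a b (h | h)
        · exact Or.inl h.symm
        · exact Or.inr h.symm
      trans := by
        rintro a b c (rfl | h) (rfl | h')
        · exact Or.inl rfl
        · exact Or.inr h'
        · exact Or.inr h
        · exact Or.inr ⟨h.1, h'.2⟩ }
  mul' := by
    rintro a b c d (rfl | h) (rfl | h')
    · exact Or.inl rfl
    · exact Or.inr ⟨I.mul_mem_left _ h'.1, I.mul_mem_left _ h'.2⟩
    · exact Or.inr ⟨I.mul_mem_right _ h.1, I.mul_mem_right _ h.2⟩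
    · exact Or.inr ⟨I.mul_mem_left _ h'.1, I.mul_mem_left _ h'.2⟩

/-- The Rees factor semigroup `S / I`; in particular `S / ∅ = S`. -/
abbrev Quot (I : SIdeal S) : Type u := I.con.Quotient

/-- The ideal `I ∪ {0}` of the semigroup `S` with a new zero adjoined. -/
def adjoinZero (I : SIdeal S) : SIdeal (WithZero S) where
  carrier := {a | ∀ s : S, a = (s : WithZero S) → s ∈ I}
  mul_mem_left s a ha := by
    intro t ht
    induction s using WithZero.recZeroCoe with
    | zero => simp at ht
    | coe s =>
      induction a using WithZero.recZeroCoe with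
      | zero => simp at ht
      | coe a =>
        rw [← WithZero.coe_mul, WithZero.coe_inj] at ht
        exact ht ▸ I.mul_mem_left s (ha a rfl)
  mul_mem_right s a ha := by
    intro t ht
    induction s using WithZero.recZeroCoe with
    | zero => simp at ht
    | coe s =>
      induction a using WithZero.recZeroCoe with
      | zero => simp at ht
      | coe a =>
        rw [← WithZero.coe_mul, WithZero.coe_inj] at ht
        exact ht ▸ I.mul_mem_right s (ha a rfl)

/-- The semigroup with zero `(S / I)⁰`: its elements are those of `S \ I` and a zero `θ`, to which
all elements of `I` are sent. For `I ≠ ∅` this is `S / I`, for `I = ∅` a zero is adjoined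
to `S`. -/
abbrev QuotZero (I : SIdeal S) : Type u := I.adjoinZero.Quot

instance (I : SIdeal S) : Zero I.QuotZero := ⟨((0 : WithZero S) : I.adjoinZero.con.Quotient)⟩

/-- The natural map `S → (S / I)⁰`. -/
def toQuotZero (I : SIdeal S) (s : S) : I.QuotZero :=
  ((s : WithZero S) : I.adjoinZero.con.Quotient)

/-- For an ideal `B` (usually containing `I`), the subset `(B / I)⁰` of `(S / I)⁰`. -/
def imageZero (I B : SIdeal S) : Set I.QuotZero := insert 0 (I.toQuotZero '' (B : Set S))

end SIdeal

/-! ### Pseudo-nilpotent semigroups -/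

/-- The subsemigroup `⟨x, y, w₁, …, wₘ⟩`; the parameters `wᵢ` equal to the adjoined identity are
left out. -/
def genSub {S : Type u} [Mul S] (x y : S) (w : ℕ → Option S) (m : ℕ) : Subsemigroup S :=
  Subsemigroup.closure ({x, y} ∪ {s | ∃ i < m, w i = some s})

theorem malcev_mem {S : Type u} [Mul S] (x y : S) (w : ℕ → Option S) (m : ℕ) :
    ∀ i : ℕ, i ≤ m →
      (malcev x y w i).1 ∈ genSub x y w m ∧ (malcev x y w i).2 ∈ genSub x y w m
  | 0, _ => ⟨Subsemigroup.subset_closure (by simp [malcev]),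
      Subsemigroup.subset_closure (by simp [malcev])⟩
  | i + 1, hi => by
    have ih := malcev_mem x y w m i (by omega)
    simp only [malcev]
    cases hw : w i with
    | none =>
      simp only [mid]
      exact ⟨mul_mem ih.1 ih.2, mul_mem ih.2 ih.1⟩
    | some s =>
      have hs : s ∈ genSub x y w m :=
        Subsemigroup.subset_closure (Or.inr ⟨i, by omega, hw⟩)
      simp only [mid]
      exact ⟨mul_mem (mul_mem ih.1 hs) ih.2, mul_mem (mul_mem ih.2 hs) ih.1⟩

/-- `λᵢ` as an element of `⟨x, y, w₁, …, wₘ⟩`, for `i ≤ m`. -/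
def lam {S : Type u} [Mul S] (x y : S) (w : ℕ → Option S) (m i : ℕ) (hi : i ≤ m) :
    genSub x y w m := ⟨(malcev x y w i).1, (malcev_mem x y w m i hi).1⟩

/-- `ρᵢ` as an element of `⟨x, y, w₁, …, wₘ⟩`, for `i ≤ m`. -/
def rho {S : Type u} [Mul S] (x y : S) (w : ℕ → Option S) (m i : ℕ) (hi : i ≤ m) :
    genSub x y w m := ⟨(malcev x y w i).2, (malcev_mem x y w m i hi).2⟩

/-- Pseudo-nilpotent semigroups. -/
def IsPseudoNilpotent (S : Type u) [Mul S] : Prop :=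
  ∀ (x y : S) (w : ℕ → Option S) (t m : ℕ), t < m →
    (malcev x y w t).1 ≠ (malcev x y w t).2 →
    malcev x y w t = malcev x y w m →
    ∀ I : SIdeal (genSub x y w m), lam x y w m m le_rfl ∉ I → rho x y w m m le_rfl ∉ I →
      ∀ (i : ℕ) (hi : i ≤ m),
        (nonNilGraph I.Quot).Adj (lam x y w m i hi : I.con.Quotient)
          (rho x y w m i hi : I.con.Quotient)

/-! ### Rees matrix semigroups and pseudo-nilpotent homomorphisms -/

/-- The elements of the Rees matrix semigroup `M⁰(G, I, Λ; P)`: the zero and the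
triples `(g; i, l)`. -/
inductive ReesMatrixZero {G I Λ : Type u} (P : Λ → I → WithZero G) : Type u
  | zero : ReesMatrixZero P
  | elt (g : G) (i : I) (l : Λ) : ReesMatrixZero P

/-- `(g; i, l) (h; j, k) = (g p_{l j} h; i, k)`, to be read as zero if `p_{l j} = 0`. -/
instance {G I Λ : Type u} [Mul G] (P : Λ → I → WithZero G) : Mul (ReesMatrixZero P) where
  mul a b :=
    match a, b with
    | .elt g i l, .elt h j k =>
      WithZero.recZeroCoe (motive := fun _ => ReesMatrixZero P) .zero
        (fun p => .elt (g * p * h) i k) (P l j)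
    | _, _ => .zero

/-- An identification of an ideal `J` of a semigroup with a regular Rees matrix
semigroup `M⁰(G, I, Λ; P)` over a group `G`, i.e. an isomorphism `φ` from the latter onto `J`. -/
structure ReesCoordinates (S : Type u) [Mul S] (J : Set S) where
  G : Type u
  I : Type u
  Λ : Type u
  [group : Group G]
  P : Λ → I → WithZero G
  row_regular : ∀ l, ∃ i, P l i ≠ 0
  col_regular : ∀ i, ∃ l, P l i ≠ 0
  φ : ReesMatrixZero P →ₙ* S
  injective : Function.Injective φ
  range_eq : Set.range φ = J

/-- The set `F_J(S) = {s ∈ S \ J | sj ≠ θ or js ≠ θ for some j ∈ J}`, for an ideal `J` of a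
semigroup `S` with zero `θ`. -/
def FSet {S : Type u} [Mul S] [Zero S] (J : Set S) : Set S :=
  {s | s ∉ J ∧ ∃ j ∈ J, s * j ≠ 0 ∨ j * s ≠ 0}

open Classical in
/-- The pseudo-nilpotent homomorphism `Φ : S → (I × Λ)⁰` of a semigroup `S` with zero `θ` and an
ideal `J = M⁰(G, I, Λ; P)`: an element `a` of `F_J(S) ∪ (J \ {θ})` is sent to the
pair `(e, f)` such that there is no edge in the upper non-nilpotent graph of `S`
between `a` and `(g; e, f)` for every `g`; the other elements are sent to `θ` (here `none`). -/
noncomputable def ReesCoordinates.Φ {S : Type u} [Mul S] [Zero S] {J : Set S}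
    (c : ReesCoordinates S J) (a : S) : Option (c.I × c.Λ) :=
  if h : a ∈ FSet J ∪ (J \ {0}) ∧
      ∃ p : c.I × c.Λ, ∀ g : c.G, ¬ (nonNilGraph S).Adj a (c.φ (.elt g p.1 p.2)) then
    some h.2.choose
  else none

/-! ### Principal series, roots, stems and connections -/

/-- A principal series `S = S₀ ⊃ S₁ ⊃ ⋯ ⊃ Sₘ = ∅` of ideals, without ideals strictly between
consecutive terms. -/
structure PrincipalSeries (S : Type u) [Mul S] where
  m : ℕ
  ideal : Fin (m + 1) → SIdeal S
  first : (ideal 0 : Set S) = Set.univ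
  last : (ideal (Fin.last m) : Set S) = ∅
  ssubset : ∀ i : Fin m, (ideal i.succ : Set S) ⊂ (ideal i.castSucc : Set S)
  no_between : ∀ (i : Fin m) (I : SIdeal S),
    ¬ ((ideal i.succ : Set S) ⊂ (I : Set S) ∧ (I : Set S) ⊂ (ideal i.castSucc : Set S))

namespace PrincipalSeries

variable {S : Type u} [Mul S] (σ : PrincipalSeries S)

/-- The ideal `Sᵢ`. -/
abbrev top (i : Fin σ.m) : SIdeal S := σ.ideal i.castSucc

/-- The ideal `Sᵢ₊₁`. -/
abbrev bot (i : Fin σ.m) : SIdeal S := σ.ideal i.succ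

/-- The set `Sᵢ \ Sᵢ₊₁`. -/
def layer (i : Fin σ.m) : Set S := (σ.top i : Set S) \ (σ.bot i : Set S)

/-- The principal factor `Sᵢ / Sᵢ₊₁` is nilpotent. -/
def FactorNilp (i : Fin σ.m) : Prop :=
  IsNilp ((σ.bot i).restrict (σ.top i).toSub).Quot

/-- The principal factor `(Sᵢ / Sᵢ₊₁)⁰` as an ideal of `(S / Sᵢ₊₁)⁰`. -/
def factorIdeal (i : Fin σ.m) : Set (σ.bot i).QuotZero := (σ.bot i).imageZero (σ.top i)

/-- `F_{Sᵢ / Sᵢ₊₁}(S / Sᵢ₊₁)`, viewed as a subset of `S`. -/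
def F (i : Fin σ.m) : Set S := {s | (σ.bot i).toQuotZero s ∈ FSet (σ.factorIdeal i)}

/-- `Sᵢ \ Sᵢ₊₁` is a root. -/
def IsRoot (i : Fin σ.m) : Prop :=
  ¬ σ.FactorNilp i ∧ ∀ a ∈ σ.layer i, ∀ b ∈ σ.bot i, ¬ (nonNilGraph S).Adj a b

/-- The set `S⁽ⁱ⁾`, the union of all `Sⱼ \ Sⱼ₊₁` with `j ≤ i` that are contained
in `F_{Sᵢ / Sᵢ₊₁}(S / Sᵢ₊₁) ∪ (Sᵢ \ Sᵢ₊₁)`. It is called a stem if `Sᵢ \ Sᵢ₊₁` is a root. -/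
def stem (i : Fin σ.m) : Set S :=
  {s | ∃ j ≤ i, σ.layer j ⊆ σ.F i ∪ σ.layer i ∧ s ∈ σ.layer j}

/-- `Sⱼ \ Sⱼ₊₁` is a connection between the two distinct stems `S⁽ⁱ⁾` and `S⁽ᵏ⁾`. -/
def IsConnection (j i k : Fin σ.m) : Prop :=
  σ.IsRoot i ∧ σ.IsRoot k ∧ σ.stem i ≠ σ.stem k ∧ σ.layer j ⊆ σ.stem i ∩ σ.stem k

/-- The subset `D` of `S` intersects two different pseudo-nilpotent classes (fibres) of the
pseudo-nilpotent homomorphism `Φᵢ` with domain `(S / Sᵢ₊₁)⁰`, which is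
formed with respect to an identification of `(Sᵢ / Sᵢ₊₁)⁰` with a regular Rees matrix
semigroup. -/
def MeetsTwoClasses (i : Fin σ.m) (D : Set S) : Prop :=
  ∃ c : ReesCoordinates (σ.bot i).QuotZero (σ.factorIdeal i),
    ∃ a ∈ D, ∃ b ∈ D, c.Φ ((σ.bot i).toQuotZero a) ≠ c.Φ ((σ.bot i).toQuotZero b)

/-- Strong pseudo-nilpotent semigroups (with respect to the given principal series). -/
def IsStrongPseudoNilpotent : Prop :=
  IsPseudoNilpotent S ∧
  (∀ j i k : Fin σ.m, σ.IsConnection j i k →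
    σ.MeetsTwoClasses i (σ.layer j) ∧ σ.MeetsTwoClasses k (σ.layer j)) ∧
  (∀ i j : Fin σ.m, i < j →
    (∃ a ∈ σ.layer i, ∃ b ∈ σ.layer j, (nonNilGraph S).Adj a b) → σ.layer i ⊆ σ.F j)

end PrincipalSeries

/-! ### The sets `K` and `K_a` -/

/-- The nilpotent ideals of `S`, as subsets of `S`. -/
def nilpIdeals (S : Type u) [Mul S] : Set (Set S) :=
  {A | ∃ I : SIdeal S, (I : Set S) = A ∧ IsNilp I.toSub}

/-- The union `K` of all nilpotent ideals of `S`: it is the largest nilpotent ideal as soon as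
there is one. -/
def K (S : Type u) [Mul S] : Set S := ⋃₀ nilpIdeals S

/-- `K_a = {s ∈ S | as ∉ K}`. -/
def KSet {S : Type u} [Mul S] (a : S) : Set S := {s | a * s ∉ K S}

end PseudoNilpotent

/-! All computations take place in the finite monoid `S¹` (`WithOne S`) with Green's relations. By
finiteness, a subsemigroup or a Rees quotient of it fails to be nilpotent exactly when it carries a
Mal'cev sequence that never merges modulo the collapsed ideal (`not_isNilp_iff`), and such a
sequence eventually stays in one 𝓙-class, called a core. Pseudo-nilpotency enters only through
`HasInnerSequences`: a never merging sequence starting at `x`, `y`, with arbitrary parameters,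
yields one inside `⟨x, y⟩`.

This forces the 𝓙-class of a core to be closed under products (`NeverMergeIn.closedClass`). If a
product left the class, one could build a never merging sequence starting at some `x`, `y` whose
product `x y` leaves the class, whereas modulo the elements not above the class `⟨x, y⟩` has no such
sequence. Hence the elements above a core `z` form a subsemigroup that acts on the 𝓡- and 𝓛-classes
inside the class of `z`. Two elements that act differently are adjacent, and not all act alike, so
everything above `z` lies in one component (`IsCore.reachable`). Conversely every edge has a minimal
core below both of its ends. It follows that `K` consists of the elements above no core, and that `s
∈ K_a` exactly when some minimal core lies below both `a` and `s` (`mem_KSet_iff`); in particular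
`K_a` lies in a single component.

If the set of minimal cores below `a` is maximal, then `K_a` is a whole component
(`mem_KSet_of_adj`). Indeed, an edge leaving `K_a` would start at some `x` above minimal cores `k`,
below `a`, and `l`, not below `a`. The 𝓙-class of `x` is then a connection between the stems of `k`
and `l`. By (H1) it contains an element adjacent to `a`, so by (H2) `x` and `a` are 𝓙-comparable,
and either order puts `l` below `a`. Since `K_a` grows with its set of minimal cores, these
components are the maximal sets `K_a`. -/

namespace PseudoNilpotent

/-! ### Green's preorders in finite monoids -/

section Green

variable {M : Type*} [Monoid M]

/-- `x` lies in the two-sided ideal generated by `y`. -/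
def JLe (x y : M) : Prop := ∃ a b, x = a * y * b

/-- `x` lies in the right ideal generated by `y`. -/
def RLe (x y : M) : Prop := ∃ b, x = y * b

/-- `x` lies in the left ideal generated by `y`. -/
def LLe (x y : M) : Prop := ∃ a, x = a * y

/-- Green's relation `𝓙`. -/
def JEq (x y : M) : Prop := JLe x y ∧ JLe y x

/-- Green's relation `𝓡`. -/
def REq (x y : M) : Prop := RLe x y ∧ RLe y x

/-- Green's relation `𝓛`. -/
def LEq (x y : M) : Prop := LLe x y ∧ LLe y x

theorem JLe.refl (x : M) : JLe x x := ⟨1, 1, by simp⟩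

theorem JLe.trans {x y z : M} : JLe x y → JLe y z → JLe x z := by
  rintro ⟨a, b, rfl⟩ ⟨c, d, rfl⟩
  exact ⟨a * c, d * b, by simp only [mul_assoc]⟩

theorem RLe.refl (x : M) : RLe x x := ⟨1, by simp⟩

theorem RLe.trans {x y z : M} : RLe x y → RLe y z → RLe x z := by
  rintro ⟨b, rfl⟩ ⟨d, rfl⟩
  exact ⟨d * b, by simp only [mul_assoc]⟩

theorem LLe.refl (x : M) : LLe x x := ⟨1, by simp⟩

theorem LLe.trans {x y z : M} : LLe x y → LLe y z → LLe x z := by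
  rintro ⟨b, rfl⟩ ⟨d, rfl⟩
  exact ⟨b * d, by simp only [mul_assoc]⟩

theorem RLe.jLe {x y : M} : RLe x y → JLe x y := fun ⟨b, h⟩ => ⟨1, b, by simpa using h⟩

theorem LLe.jLe {x y : M} : LLe x y → JLe x y := fun ⟨a, h⟩ => ⟨a, 1, by simpa using h⟩

theorem JEq.refl (x : M) : JEq x x := ⟨.refl x, .refl x⟩

theorem JEq.symm {x y : M} (h : JEq x y) : JEq y x := ⟨h.2, h.1⟩

theorem JEq.trans {x y z : M} (h : JEq x y) (h' : JEq y z) : JEq x z :=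
  ⟨h.1.trans h'.1, h'.2.trans h.2⟩

theorem REq.refl (x : M) : REq x x := ⟨.refl x, .refl x⟩

theorem REq.symm {x y : M} (h : REq x y) : REq y x := ⟨h.2, h.1⟩

theorem REq.trans {x y z : M} (h : REq x y) (h' : REq y z) : REq x z :=
  ⟨h.1.trans h'.1, h'.2.trans h.2⟩

theorem LEq.refl (x : M) : LEq x x := ⟨.refl x, .refl x⟩

theorem LEq.symm {x y : M} (h : LEq x y) : LEq y x := ⟨h.2, h.1⟩

theorem LEq.trans {x y z : M} (h : LEq x y) (h' : LEq y z) : LEq x z :=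
  ⟨h.1.trans h'.1, h'.2.trans h.2⟩

theorem REq.jEq {x y : M} (h : REq x y) : JEq x y := ⟨h.1.jLe, h.2.jLe⟩

theorem LEq.jEq {x y : M} (h : LEq x y) : JEq x y := ⟨h.1.jLe, h.2.jLe⟩

theorem JLe.mul_left (x y : M) : JLe (x * y) x := ⟨1, y, by simp⟩

theorem JLe.mul_right (x y : M) : JLe (x * y) y := ⟨x, 1, by simp⟩

theorem REq.mul_left {x y : M} (h : REq x y) (s : M) : REq (s * x) (s * y) := by
  obtain ⟨⟨a, ha⟩, ⟨b, hb⟩⟩ := h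
  exact ⟨⟨a, by rw [mul_assoc, ← ha]⟩, ⟨b, by rw [mul_assoc, ← hb]⟩⟩

theorem LEq.mul_right {x y : M} (h : LEq x y) (s : M) : LEq (x * s) (y * s) := by
  obtain ⟨⟨a, ha⟩, ⟨b, hb⟩⟩ := h
  exact ⟨⟨a, by rw [← mul_assoc, ← ha]⟩, ⟨b, by rw [← mul_assoc, ← hb]⟩⟩

theorem JLe.mul_of_lLe_of_rLe {a p b q : M} : LLe p a → RLe q b → JLe (p * q) (a * b) := by
  rintro ⟨u, rfl⟩ ⟨v, rfl⟩
  exact ⟨u, v, by simp only [mul_assoc]⟩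

theorem eq_pow_mul_mul_pow {y a c : M} (h : y = a * y * c) (n : ℕ) : y = a ^ n * y * c ^ n := by
  induction n with
  | zero => simp
  | succ n ih =>
    calc y = a ^ n * y * c ^ n := ih
      _ = a ^ n * (a * y * c) * c ^ n := by rw [← h]
      _ = _ := by rw [pow_succ, pow_succ']; simp only [mul_assoc]

variable [Finite M]

theorem exists_pow_eq_pow (c : M) : ∃ i k : ℕ, c ^ (i + (k + 1)) = c ^ i := by
  obtain ⟨i, j, hij, h⟩ := Finite.exists_ne_map_eq_of_infinite (fun n : ℕ => c ^ n)
  rcases lt_or_gt_of_ne hij with hlt | hlt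
  · exact ⟨i, j - i - 1, by rw [show i + (j - i - 1 + 1) = j by omega]; exact h.symm⟩
  · exact ⟨j, i - j - 1, by rw [show j + (i - j - 1 + 1) = i by omega]; exact h⟩

/-- Iterating gives `y = a ^ i * y * c ^ i` for every `i`; the powers of `c` are eventually
periodic, and for `i` in the periodic part a further period on the right changes nothing. -/
theorem exists_eq_mul_pow {y a c : M} (h : y = a * y * c) : ∃ n : ℕ, y = y * c ^ (n + 1) := by
  obtain ⟨i, k, hik⟩ := exists_pow_eq_pow c
  refine ⟨k, ?_⟩
  calc y = a ^ i * y * c ^ i := eq_pow_mul_mul_pow h i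
    _ = a ^ i * y * c ^ i * c ^ (k + 1) := by rw [mul_assoc _ (c ^ i), ← pow_add, hik]
    _ = y * c ^ (k + 1) := by rw [← eq_pow_mul_mul_pow h i]

theorem exists_eq_pow_mul {y a c : M} (h : y = a * y * c) : ∃ n : ℕ, y = a ^ (n + 1) * y := by
  obtain ⟨i, k, hik⟩ := exists_pow_eq_pow a
  refine ⟨k, ?_⟩
  calc y = a ^ i * y * c ^ i := eq_pow_mul_mul_pow h i
    _ = a ^ (k + 1) * (a ^ i * y * c ^ i) := by
        rw [mul_assoc (a ^ i), ← mul_assoc (a ^ (k + 1)), ← pow_add, add_comm, hik]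
    _ = a ^ (k + 1) * y := by rw [← eq_pow_mul_mul_pow h i]

/-- Stability of finite monoids. -/
theorem RLe.symm_of_jLe {x y : M} (h : JLe y x) (h' : RLe x y) : RLe y x := by
  obtain ⟨a, b, hab⟩ := h
  obtain ⟨u, rfl⟩ := h'
  -- With `x = y u`, the relation `y = a x b` reads `y = a y (u b)`. Then `y = y (u b)^(n+1)`, which
  -- begins with `y u = x`.
  obtain ⟨n, hn⟩ := exists_eq_mul_pow (y := y) (a := a) (c := u * b)
    (by simpa only [mul_assoc] using hab)
  refine ⟨b * (u * b) ^ n, ?_⟩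
  rw [pow_succ'] at hn
  simpa only [mul_assoc] using hn

theorem LLe.symm_of_jLe {x y : M} (h : JLe y x) (h' : LLe x y) : LLe y x := by
  obtain ⟨a, b, hab⟩ := h
  obtain ⟨u, rfl⟩ := h'
  obtain ⟨n, hn⟩ := exists_eq_pow_mul (y := y) (a := a * u) (c := b)
    (by simpa only [mul_assoc] using hab)
  refine ⟨(a * u) ^ n * a, ?_⟩
  rw [pow_succ] at hn
  simpa only [mul_assoc] using hn

theorem REq.mul_of_jLe {a b : M} (h : JLe a (a * b)) : REq (a * b) a :=
  ⟨⟨b, rfl⟩, .symm_of_jLe h ⟨b, rfl⟩⟩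

theorem LEq.mul_of_jLe {a b : M} (h : JLe b (a * b)) : LEq (a * b) b :=
  ⟨⟨a, rfl⟩, .symm_of_jLe h ⟨a, rfl⟩⟩

/-- This is 𝓙 = 𝓓 in a finite monoid: if `v = p u q`, stability places `u q` in the 𝓡-class of `u`
and the 𝓛-class of `v`. -/
theorem exists_rEq_lEq {u v : M} (h : JEq u v) : ∃ x, REq x u ∧ LEq x v := by
  obtain ⟨⟨a, b, hab⟩, ⟨p, q, hpq⟩⟩ := h
  have h1 : JLe v (u * q) := ⟨p, 1, by rw [hpq]; simp [mul_assoc]⟩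
  have h2 : JLe u v := ⟨a, b, hab⟩
  refine ⟨u * q, .mul_of_jLe (h2.trans h1), ?_⟩
  have h3 : v = p * (u * q) := by rw [hpq, mul_assoc]
  have : LEq (p * (u * q)) (u * q) :=
    .mul_of_jLe (by rw [← h3]; exact (JLe.mul_left u q).trans h2)
  rw [← h3] at this
  exact this.symm

/-- An element that is `𝓙`-equivalent to a product `y * t * y` is regular. -/
theorem exists_mul_mul_eq_self {y t : M} (h : JLe y (y * t * y)) : ∃ a, y * a * y = y := by
  obtain ⟨v, hv⟩ : RLe y (y * t * y) :=
    .symm_of_jLe h ⟨t * y, by simp only [mul_assoc]⟩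
  obtain ⟨n, hn⟩ := exists_eq_pow_mul (y := y) (a := y * t) (c := v) hv
  refine ⟨t * (y * t) ^ n, ?_⟩
  rw [pow_succ'] at hn
  simpa only [mul_assoc] using hn.symm

end Green

/-! ### Mal'cev sequences in monoids -/

section Malcev

variable {M : Type*} [Monoid M]

/-- The pair `(λₙ, ρₙ)` of the Mal'cev sequence in a monoid. -/
def mal (x y : M) (w : ℕ → M) : ℕ → M × M
  | 0 => (x, y)
  | n + 1 => ((mal x y w n).1 * w n * (mal x y w n).2, (mal x y w n).2 * w n * (mal x y w n).1)

/-- The Mal'cev sequence of `x`, `y`, `w` never merges modulo the ideal `A`. -/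
def NeverMerge (x y : M) (w : ℕ → M) (A : Set M) : Prop :=
  ∀ n, (mal x y w n).1 ≠ (mal x y w n).2 ∧ (mal x y w n).1 ∉ A ∧ (mal x y w n).2 ∉ A

/-- `A` is an ideal of the monoid `M`. -/
def IsIdealSet (A : Set M) : Prop := ∀ a b x, x ∈ A → a * x * b ∈ A

/-- The ideal of all elements that do not generate `z`. -/
def notAbove (z : M) : Set M := {m | ¬ JLe z m}

theorem isIdealSet_notAbove (z : M) : IsIdealSet (notAbove z) :=
  fun a b _ hx h => hx (h.trans ⟨a, b, rfl⟩)

theorem IsIdealSet.mem_of_jLe {A : Set M} (hA : IsIdealSet A) {x y : M} (h : JLe x y)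
    (hy : y ∈ A) : x ∈ A := by
  obtain ⟨a, b, rfl⟩ := h
  exact hA a b y hy

/-- Each pair whose Mal'cev sequence never merges generates a subsemigroup that contains a
never merging Mal'cev sequence. The set `S₀` is the set of admissible initial values. -/
def HasInnerSequences (S₀ : Set M) : Prop :=
  ∀ x ∈ S₀, ∀ y ∈ S₀, ∀ (w : ℕ → M) (A : Set M), IsIdealSet A → NeverMerge x y w A →
    ∃ x' ∈ Subsemigroup.closure {x, y}, ∃ y' ∈ Subsemigroup.closure {x, y}, ∃ w' : ℕ → M,
      (∀ n, w' n = 1 ∨ w' n ∈ Subsemigroup.closure {x, y}) ∧ NeverMerge x' y' w' A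

theorem mal_jLe_of_lt (x y : M) (w : ℕ → M) {n m : ℕ} (h : n < m) :
    (JLe (mal x y w m).1 (mal x y w n).1 ∧ JLe (mal x y w m).1 (mal x y w n).2) ∧
      (JLe (mal x y w m).2 (mal x y w n).1 ∧ JLe (mal x y w m).2 (mal x y w n).2) := by
  have step : ∀ k, (JLe (mal x y w (k + 1)).1 (mal x y w k).1 ∧
      JLe (mal x y w (k + 1)).1 (mal x y w k).2) ∧ (JLe (mal x y w (k + 1)).2 (mal x y w k).1 ∧
      JLe (mal x y w (k + 1)).2 (mal x y w k).2) := fun k =>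
    ⟨⟨(JLe.mul_left _ _).trans (JLe.mul_left _ _), JLe.mul_right _ _⟩,
      ⟨JLe.mul_right _ _, (JLe.mul_left _ _).trans (JLe.mul_left _ _)⟩⟩
  induction m, h using Nat.le_induction with
  | base => exact step n
  | succ m _ ih =>
    exact ⟨⟨(step m).1.1.trans ih.1.1, (step m).1.1.trans ih.1.2⟩,
      ⟨(step m).2.1.trans ih.1.1, (step m).2.1.trans ih.1.2⟩⟩

theorem mal_add (x y : M) (w : ℕ → M) (N n : ℕ) :
    mal (mal x y w N).1 (mal x y w N).2 (fun i => w (N + i)) n = mal x y w (N + n) := by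
  induction n with
  | zero => rfl
  | succ n ih => rw [mal, ih]; rfl

theorem NeverMerge.shift {x y : M} {w : ℕ → M} {A : Set M} (h : NeverMerge x y w A) (N : ℕ) :
    NeverMerge (mal x y w N).1 (mal x y w N).2 (fun i => w (N + i)) A := by
  intro n
  rw [mal_add]
  exact h _

theorem mal_mem_of_subsemigroup {U : Subsemigroup M} {x y : M} {w : ℕ → M} (hx : x ∈ U)
    (hy : y ∈ U) (hw : ∀ n, w n = 1 ∨ w n ∈ U) (n : ℕ) :
    (mal x y w n).1 ∈ U ∧ (mal x y w n).2 ∈ U := by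
  induction n with
  | zero => exact ⟨hx, hy⟩
  | succ n ih =>
    rcases hw n with h | h
    · simp only [mal, h, mul_one]
      exact ⟨mul_mem ih.1 ih.2, mul_mem ih.2 ih.1⟩
    · exact ⟨mul_mem (mul_mem ih.1 h) ih.2, mul_mem (mul_mem ih.2 h) ih.1⟩

/-- The Mal'cev sequence of `x`, `y`, `w` never merges and stays in the `𝓙`-class of `z`. -/
def NeverMergeIn (x y : M) (w : ℕ → M) (z : M) : Prop :=
  ∀ n, (mal x y w n).1 ≠ (mal x y w n).2 ∧ JEq (mal x y w n).1 z ∧ JEq (mal x y w n).2 z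

theorem NeverMergeIn.neverMerge {x y : M} {w : ℕ → M} {z : M} (h : NeverMergeIn x y w z) :
    NeverMerge x y w (notAbove z) :=
  fun n => ⟨(h n).1, fun h' => h' (h n).2.1.2, fun h' => h' (h n).2.2.2⟩

/-- A never merging sequence in a finite monoid eventually stays in one `𝓙`-class. -/
theorem NeverMerge.exists_neverMergeIn [Finite M] {x y : M} {w : ℕ → M} {A : Set M}
    (h : NeverMerge x y w A) : ∃ N, JLe (mal x y w N).1 x ∧ JLe (mal x y w N).1 y ∧
      NeverMergeIn (mal x y w N).1 (mal x y w N).2 (fun i => w (N + i)) (mal x y w N).1 := by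
  obtain ⟨p, hp⟩ := Finite.exists_infinite_fiber (mal x y w)
  have hinf := Set.infinite_coe_iff.mp hp
  -- Some pair recurs infinitely often. The sequence descends in the 𝓙-order, so between two
  -- occurrences it cannot leave the 𝓙-class. Taking `N > 0` puts this class below both `x` and `y`.
  obtain ⟨N, hN, hN0⟩ := hinf.exists_gt 0
  have down : ∀ n, JLe (mal x y w N).1 (mal x y w (N + n)).1 ∧
      JLe (mal x y w N).1 (mal x y w (N + n)).2 := by
    intro n
    obtain ⟨k, hk, hk0⟩ := hinf.exists_gt (N + n)
    have e : mal x y w k = mal x y w N := by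
      rw [Set.mem_preimage, Set.mem_singleton_iff] at hk hN
      rw [hk, hN]
    rw [← e]
    exact (mal_jLe_of_lt x y w hk0).1
  have up : ∀ n, JLe (mal x y w (N + n)).1 (mal x y w N).1 ∧
      JLe (mal x y w (N + n)).2 (mal x y w N).1 := by
    intro n
    obtain ⟨k, hk, hk0⟩ := hinf.exists_gt N
    have e : mal x y w k = mal x y w N := by
      rw [Set.mem_preimage, Set.mem_singleton_iff] at hk hN
      rw [hk, hN]
    rcases Nat.eq_zero_or_pos n with rfl | hn
    · refine ⟨.refl _, ?_⟩
      have := (mal_jLe_of_lt x y w hk0).2.1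
      rwa [e] at this
    · have := mal_jLe_of_lt x y w (show N < N + n by omega)
      exact ⟨this.1.1, this.2.1⟩
  refine ⟨N, (mal_jLe_of_lt x y w hN0).1.1, (mal_jLe_of_lt x y w hN0).1.2, fun n => ?_⟩
  rw [mal_add]
  exact ⟨(h _).1, ⟨(up n).1, (down n).1⟩, ⟨(up n).2, (down n).2⟩⟩

/-! ### Passing to the opposite monoid -/

-- Reversing products turns `λ w ρ` into `ρ w λ`, so the two components change places at every step.
open MulOpposite in
theorem mal_op (x y : M) (w : ℕ → M) (n : ℕ) :
    mal (op x) (op y) (fun i => op (w i)) n = (op (mal x y w n).1, op (mal x y w n).2) ∨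
    mal (op x) (op y) (fun i => op (w i)) n = (op (mal x y w n).2, op (mal x y w n).1) := by
  induction n with
  | zero => exact .inl rfl
  | succ n ih =>
    rcases ih with ih | ih
    · right; simp only [mal, ih, ← op_mul, mul_assoc]
    · left; simp only [mal, ih, ← op_mul, mul_assoc]

open MulOpposite in
theorem NeverMerge.op {x y : M} {w : ℕ → M} {A : Set M} (h : NeverMerge x y w A) :
    NeverMerge (op x) (op y) (fun i => op (w i)) (unop ⁻¹' A) := by
  intro n
  have := h n
  rcases mal_op x y w n with e | e
  · rw [e]; simpa using this
  · rw [e]; simpa [eq_comm, and_comm] using this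

open MulOpposite in
theorem HasInnerSequences.op {S₀ : Set M} (h : HasInnerSequences S₀) :
    HasInnerSequences (unop ⁻¹' S₀ : Set Mᵐᵒᵖ) := by
  intro x hx y hy w A hA hxy
  have mem : ∀ a : M, a ∈ Subsemigroup.closure {unop x, unop y} →
      MulOpposite.op a ∈ Subsemigroup.closure {x, y} := by
    intro a ha
    induction ha using Subsemigroup.closure_induction with
    | mem a ha =>
      rcases ha with rfl | rfl
      · exact Subsemigroup.subset_closure (by simp)
      · exact Subsemigroup.subset_closure (by simp)
    | mul a b _ _ iha ihb => rw [op_mul]; exact mul_mem ihb iha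
  have hxy' : NeverMerge (unop x) (unop y) (fun i => unop (w i)) (MulOpposite.op ⁻¹' A) := by
    intro n
    have := hxy n
    rcases mal_op (unop x) (unop y) (fun i => unop (w i)) n with e | e
    · simp only [op_unop] at e
      rw [e] at this
      simpa using this
    · simp only [op_unop] at e
      rw [e] at this
      simpa [eq_comm, and_comm] using this
  obtain ⟨x', hx', y', hy', w', hw', h'⟩ := h _ hx _ hy _ (MulOpposite.op ⁻¹' A)
    (fun a b c hc => by
      have := hA (MulOpposite.op b) (MulOpposite.op a) (MulOpposite.op c) hc
      simpa [mul_assoc] using this) hxy'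
  refine ⟨_, mem _ hx', _, mem _ hy', fun i => MulOpposite.op (w' i), fun n => ?_, h'.op⟩
  rcases hw' n with h | h
  · exact .inl (congrArg MulOpposite.op h)
  · exact .inr (mem _ h)

end Malcev

/-! ### Closure of a 𝓙-class under products -/

section Structure

variable {M : Type*} [Monoid M]

/-- Modulo `A` every word in which an `x` is directly followed by a `y` vanishes, so only words with
all `y` in front survive. -/
theorem eq_pow_mul_pow_of_mul_mem {A : Set M} (hA : IsIdealSet A) {x y m : M} (hxy : x * y ∈ A)
    (hm : m = 1 ∨ m ∈ Subsemigroup.closure {x, y}) (hmA : m ∉ A) :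
    ∃ k l : ℕ, m = y ^ k * x ^ l := by
  rcases hm with rfl | hm
  · exact ⟨0, 0, by simp⟩
  · suffices m ∈ A ∨ ∃ k l : ℕ, m = y ^ k * x ^ l from this.resolve_left hmA
    clear hmA
    induction hm using Subsemigroup.closure_induction with
    | mem m hm =>
      rcases hm with rfl | rfl
      · exact .inr ⟨0, 1, by simp⟩
      · exact .inr ⟨1, 0, by simp⟩
    | mul a b _ _ iha ihb =>
      rcases iha with iha | ⟨k, l, rfl⟩
      · left; simpa using hA 1 b a iha
      rcases ihb with ihb | ⟨k', l', rfl⟩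
      · left; simpa using hA (y ^ k * x ^ l) 1 b ihb
      rcases l with - | l
      · exact .inr ⟨k + k', l', by simp [pow_add, mul_assoc]⟩
      rcases k' with - | k'
      · exact .inr ⟨k, l + 1 + l', by simp [pow_add, mul_assoc]⟩
      left
      have := hA (y ^ k * x ^ l) (y ^ k' * x ^ l') _ hxy
      rw [pow_succ x, pow_succ' y k']
      simpa only [mul_assoc] using this

/-- If `x * y` is zero modulo the ideal `A`, then all Mal'cev sequences in `⟨x, y⟩` merge. -/
theorem not_neverMerge_of_mul_mem {A : Set M} (hA : IsIdealSet A) {x y x' y' : M} {w : ℕ → M}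
    (hxy : x * y ∈ A) (hx' : x' ∈ Subsemigroup.closure {x, y})
    (hy' : y' ∈ Subsemigroup.closure {x, y})
    (hw : ∀ n, w n = 1 ∨ w n ∈ Subsemigroup.closure {x, y}) : ¬ NeverMerge x' y' w A := by
  intro h
  obtain ⟨hne, h1, h2⟩ := h 1
  simp only [mal] at hne h1 h2
  have hx0 : x' ∉ A := (h 0).2.1
  have hy0 : y' ∉ A := (h 0).2.2
  have hw0 : w 0 ∉ A := fun hc => h1 (hA _ _ _ hc)
  obtain ⟨a, b, rfl⟩ := eq_pow_mul_pow_of_mul_mem hA hxy (.inr hx') hx0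
  obtain ⟨c, d, rfl⟩ := eq_pow_mul_pow_of_mul_mem hA hxy (.inr hy') hy0
  obtain ⟨e, f, hef⟩ := eq_pow_mul_pow_of_mul_mem hA hxy (hw 0) hw0
  rw [hef] at hne h1 h2
  -- The three elements are `y^a x^b`, `y^c x^d` and `y^e x^f`. As neither `λ₁` nor `ρ₁` lies in
  -- `A`, no `x` may precede a `y`. The exponents that remain make `λ₁ = ρ₁` in every case.
  have Z : ∀ (k l : ℕ) (p q : M), p * x ^ k * y ^ l * q ∉ A → k = 0 ∨ l = 0 := by
    intro k l p q hpq
    by_contra! hkl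
    obtain ⟨⟨k, rfl⟩, ⟨l, rfl⟩⟩ := And.intro (Nat.exists_eq_succ_of_ne_zero hkl.1)
      (Nat.exists_eq_succ_of_ne_zero hkl.2)
    apply hpq
    have := hA (p * x ^ k) (y ^ l * q) _ hxy
    rw [Nat.succ_eq_add_one, Nat.succ_eq_add_one, pow_succ x, pow_succ' y]
    simpa only [mul_assoc] using this
  have f1 : b = 0 ∨ e = 0 := Z b e (y ^ a) (x ^ f * (y ^ c * x ^ d))
    (by simpa only [mul_assoc] using h1)
  have f2 : f = 0 ∨ c = 0 := Z f c (y ^ a * x ^ b * y ^ e) (x ^ d)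
    (by simpa only [mul_assoc] using h1)
  have g1 : d = 0 ∨ e = 0 := Z d e (y ^ c) (x ^ f * (y ^ a * x ^ b))
    (by simpa only [mul_assoc] using h2)
  have g2 : f = 0 ∨ a = 0 := Z f a (y ^ c * x ^ d * y ^ e) (x ^ b)
    (by simpa only [mul_assoc] using h2)
  have f3 : e = 0 → f = 0 → b = 0 ∨ c = 0 := by
    rintro rfl rfl
    exact Z b c (y ^ a) (x ^ d) (by simpa [mul_assoc] using h1)
  have g3 : e = 0 → f = 0 → d = 0 ∨ a = 0 := by
    rintro rfl rfl
    exact Z d a (y ^ c) (x ^ b) (by simpa [mul_assoc] using h2)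
  apply hne
  have cx : ∀ i j, x ^ i * x ^ j = x ^ (i + j) := fun i j => (pow_add x i j).symm
  have cy : ∀ i j, y ^ i * y ^ j = y ^ (i + j) := fun i j => (pow_add y i j).symm
  rcases Nat.eq_zero_or_pos e with rfl | he
  · rcases Nat.eq_zero_or_pos f with rfl | hf
    · rcases f3 rfl rfl with rfl | rfl <;> rcases g3 rfl rfl with rfl | rfl <;>
        simp [cx, cy, ← mul_assoc, add_comm]
    · obtain rfl := f2.resolve_left hf.ne'
      obtain rfl := g2.resolve_left hf.ne'
      simp [cx, add_comm, add_left_comm]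
  · obtain rfl := f1.resolve_right he.ne'
    obtain rfl := g1.resolve_right he.ne'
    rcases f2 with rfl | rfl
    · simp [cy, add_comm, add_left_comm]
    · rcases g2 with rfl | rfl
      · simp [cy, add_comm]
      · simp

section Op

open MulOpposite

theorem jLe_op {x y : M} : JLe (op x) (op y) ↔ JLe x y := by
  constructor
  · rintro ⟨a, b, h⟩
    exact ⟨unop b, unop a, by simpa [mul_assoc] using congrArg unop h⟩
  · rintro ⟨a, b, rfl⟩
    exact ⟨op b, op a, by simp [mul_assoc]⟩

theorem jEq_op {x y : M} : JEq (op x) (op y) ↔ JEq x y := and_congr jLe_op jLe_op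

theorem rLe_op {x y : M} : RLe (op x) (op y) ↔ LLe x y := by
  constructor
  · rintro ⟨a, h⟩
    exact ⟨unop a, by simpa using congrArg unop h⟩
  · rintro ⟨a, rfl⟩
    exact ⟨op a, by simp⟩

theorem rEq_op {x y : M} : REq (op x) (op y) ↔ LEq x y := and_congr rLe_op rLe_op

end Op

variable [Finite M]

/-- Inside a 𝓙-class, whether a product stays in the class depends only on the 𝓛-class of the left
factor and the 𝓡-class of the right one. -/
theorem rEq_lEq_mul_of_lLe_of_rLe {a b p q : M} (ha : LLe p a) (hb : RLe q b)
    (hpa : JLe a (p * q)) (hpb : JLe b (p * q)) : REq (a * b) a ∧ LEq (a * b) b :=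
  ⟨.mul_of_jLe (hpa.trans (.mul_of_lLe_of_rLe ha hb)),
    .mul_of_jLe (hpb.trans (.mul_of_lLe_of_rLe ha hb))⟩

/-- Suppose `z' v` falls out of the class. Choose `x`, `y` in the 𝓛-class of `z'` and in the
𝓡-classes of `u`, `v`, and `c` in the 𝓡-class of `k` and the 𝓛-class of `z`. With all parameters
equal to `c` the products stay in the class, and the sequence keeps its two distinct 𝓡-classes, so
it never merges. But `x y` falls out together with `z' v`, so no inner sequence exists. -/
theorem jLe_mul_of_not_rEq {S₀ : Set M} (hS₀ : IsIdealSet S₀) (hPN : HasInnerSequences S₀)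
    {u v z z' k j : M} (hj : j ∈ S₀) (hu : JEq u j) (hv : JEq v j) (hz : JEq z j) (hz' : JEq z' j)
    (hk : JEq k j) (huv : ¬ REq u v) (hzu : JLe j (z * u)) (hzv : JLe j (z * v))
    (hzk : JLe j (z' * k)) : JLe j (z' * v) := by
  by_contra hcon
  obtain ⟨x, hxu, hxz⟩ := exists_rEq_lEq (hu.trans hz'.symm)
  obtain ⟨y, hyv, hyz⟩ := exists_rEq_lEq (hv.trans hz'.symm)
  obtain ⟨c, hck, hcz⟩ := exists_rEq_lEq (hk.trans hz.symm)
  have step : ∀ a b t : M, LEq a z' → REq b t → JEq t j → JLe j (z * t) →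
      REq (a * c * b) a ∧ LEq (a * c * b) b := by
    intro a b t ha hb ht hzt
    have haj : JEq a j := ha.jEq.trans hz'
    have hbj : JEq b j := hb.jEq.trans ht
    have h1 := rEq_lEq_mul_of_lLe_of_rLe ha.2 hck.2 (haj.1.trans hzk)
      (hck.jEq.1.trans (hk.1.trans hzk))
    have hac : LEq (a * c) z := h1.2.trans hcz
    have h2 := rEq_lEq_mul_of_lLe_of_rLe hac.2 hb.2 (hac.jEq.1.trans (hz.1.trans hzt))
      (hbj.1.trans hzt)
    exact ⟨h2.1.trans h1.1, h2.2⟩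
  have inv : ∀ n, (REq (mal x y (fun _ => c) n).1 u ∧ LEq (mal x y (fun _ => c) n).1 z') ∧
      (REq (mal x y (fun _ => c) n).2 v ∧ LEq (mal x y (fun _ => c) n).2 z') := by
    intro n
    induction n with
    | zero => exact ⟨⟨hxu, hxz⟩, ⟨hyv, hyz⟩⟩
    | succ n ih =>
      have h1 := step _ _ v ih.1.2 ih.2.1 hv hzv
      have h2 := step _ _ u ih.2.2 ih.1.1 hu hzu
      exact ⟨⟨h1.1.trans ih.1.1, h1.2.trans ih.2.2⟩, ⟨h2.1.trans ih.2.1, h2.2.trans ih.1.2⟩⟩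
  have hNM : NeverMerge x y (fun _ => c) (notAbove j) := by
    intro n
    refine ⟨fun h => huv ?_, fun h => h ((inv n).1.2.jEq.trans hz').2,
      fun h => h ((inv n).2.2.jEq.trans hz').2⟩
    have := (inv n).2.1
    rw [← h] at this
    exact (inv n).1.1.symm.trans this
  have memS : ∀ t, JEq t j → t ∈ S₀ := fun t ht => hS₀.mem_of_jLe ht.1 hj
  obtain ⟨x', hx', y', hy', w', hw', h'⟩ := hPN x (memS _ (hxz.jEq.trans hz'))
    y (memS _ (hyz.jEq.trans hz')) _ _ (isIdealSet_notAbove j) hNM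
  exact not_neverMerge_of_mul_mem (isIdealSet_notAbove j)
    (fun h => hcon (h.trans (.mul_of_lLe_of_rLe hxz.1 hyv.1))) hx' hy' hw' h'

/-- The `𝓙`-class of `j` is closed under products. -/
def ClosedClass (j : M) : Prop := ∀ a b, JEq a j → JEq b j → JLe j (a * b)

/-- The previous lemma spreads nonvanishing products: from `z` to all left factors of `u` and `v`,
and then to an arbitrary right factor `b`, which is compared with whichever of `u`, `v` is not
𝓡-related to it. -/
theorem closedClass_of_not_rEq {S₀ : Set M} (hS₀ : IsIdealSet S₀) (hPN : HasInnerSequences S₀)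
    {u v z j : M} (hj : j ∈ S₀) (hu : JEq u j) (hv : JEq v j) (hz : JEq z j)
    (huv : ¬ REq u v) (hzu : JLe j (z * u)) (hzv : JLe j (z * v)) : ClosedClass j := by
  have reg1 : ∀ a, JEq a j → ∃ k, JEq k j ∧ JLe j (a * k) := by
    intro a ha
    obtain ⟨p, q, hpq⟩ := (hz.trans ha.symm).1
    have h1 : JLe j (a * (q * u)) := hzu.trans ⟨p, 1, by rw [hpq]; simp only [mul_assoc, mul_one]⟩
    exact ⟨q * u, ⟨(JLe.mul_right _ _).trans hu.1, h1.trans (JLe.mul_right _ _)⟩, h1⟩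
  have reg2 : ∀ b, JEq b j → ∃ k, JEq k j ∧ JLe j (k * b) := by
    intro b hb
    obtain ⟨p, q, hpq⟩ := (hu.trans hb.symm).1
    have h1 : JLe j (z * p * b) := hzu.trans ⟨1, q, by rw [hpq]; simp only [mul_assoc, one_mul]⟩
    exact ⟨z * p, ⟨(JLe.mul_left _ _).trans hz.1, h1.trans (JLe.mul_left _ _)⟩, h1⟩
  have allu : ∀ a, JEq a j → JLe j (a * u) := fun a ha => by
    obtain ⟨k, hk, hak⟩ := reg1 a ha
    exact jLe_mul_of_not_rEq hS₀ hPN hj hv hu hz ha hk (fun h => huv h.symm) hzv hzu hak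
  have allv : ∀ a, JEq a j → JLe j (a * v) := fun a ha => by
    obtain ⟨k, hk, hak⟩ := reg1 a ha
    exact jLe_mul_of_not_rEq hS₀ hPN hj hu hv hz ha hk huv hzu hzv hak
  intro a b ha hb
  obtain ⟨c, hc, hcb⟩ := reg2 b hb
  by_cases hbu : REq u b
  · exact jLe_mul_of_not_rEq hS₀ hPN hj hv hb hc ha hu
      (fun h => huv (hbu.trans h.symm)) (allv c hc) hcb (allu a ha)
  · exact jLe_mul_of_not_rEq hS₀ hPN hj hu hb hc ha hu hbu (allu c hc) hcb (allu a ha)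

open MulOpposite in
theorem closedClass_of_not_lEq {S₀ : Set M} (hS₀ : IsIdealSet S₀) (hPN : HasInnerSequences S₀)
    {u v z j : M} (hj : j ∈ S₀) (hu : JEq u j) (hv : JEq v j) (hz : JEq z j)
    (huv : ¬ LEq u v) (hzu : JLe j (u * z)) (hzv : JLe j (v * z)) : ClosedClass j := by
  have : Finite Mᵐᵒᵖ := Finite.of_equiv M opEquiv
  have := closedClass_of_not_rEq (M := Mᵐᵒᵖ) (S₀ := unop ⁻¹' S₀) (j := op j) (u := op u)
    (v := op v) (z := op z) (fun a b x hx => by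
      have := hS₀ (unop b) (unop a) (unop x) hx
      simpa [mul_assoc] using this) hPN.op hj (jEq_op.2 hu) (jEq_op.2 hv) (jEq_op.2 hz)
    (fun h => huv (rEq_op.1 h)) (by rw [← op_mul]; exact jLe_op.2 hzu)
    (by rw [← op_mul]; exact jLe_op.2 hzv)
  intro a b ha hb
  have h := this (op b) (op a) (jEq_op.2 hb) (jEq_op.2 ha)
  rw [← op_mul] at h
  exact jLe_op.1 h

end Structure

/-! ### Closed 𝓙-classes and the action of the elements above them -/

section Structure

variable {M : Type*} [Monoid M]

theorem jLe_of_mem_closure {x y z m : M} (hx : JLe x z) (hy : JLe y z)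
    (hm : m ∈ Subsemigroup.closure {x, y}) : JLe m z := by
  induction hm using Subsemigroup.closure_induction with
  | mem m hm => rcases hm with rfl | rfl <;> assumption
  | mul a b _ _ iha _ => exact (JLe.mul_left a b).trans iha

theorem commute_of_mem_closure {x y a b : M} (h : Commute x y)
    (ha : a ∈ Subsemigroup.closure {x, y}) (hb : b ∈ Subsemigroup.closure {x, y}) :
    Commute a b := by
  induction ha using Subsemigroup.closure_induction with
  | mul a a' _ _ iha iha' => exact iha.mul_left iha'
  | mem a ha =>
    induction hb using Subsemigroup.closure_induction with
    | mul b b' _ _ ihb ihb' => exact ihb.mul_right ihb'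
    | mem b hb =>
      rcases ha with rfl | rfl <;> rcases hb with rfl | rfl
      exacts [.refl _, h, h.symm, .refl _]

theorem mal_one_fst_eq_snd {x y : M} {w : ℕ → M} (hxy : Commute x y) (hx : Commute (w 0) x)
    (hy : Commute (w 0) y) : (mal x y w 1).1 = (mal x y w 1).2 := by
  simp only [mal]
  rw [← hx.eq, ← hy.eq, mul_assoc, mul_assoc, hxy.eq]

/-- Right multiplication by `a` moves the sequence to one starting at `x a`, `y a`. There `y a` is a
two-sided identity for `x a`, so `⟨x a, y a⟩` is commutative and every sequence inside it merges
after one step. -/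
theorem not_neverMerge_of_rEq_of_lEq {S₀ : Set M} (hS₀ : IsIdealSet S₀)
    (hPN : HasInnerSequences S₀) {x y a : M} {w : ℕ → M} {A : Set M} (hA : IsIdealSet A)
    (hx : x ∈ S₀) (hy : y ∈ S₀) (hR : REq x y) (hL : LEq x y) (ha : y * a * y = y) :
    ¬ NeverMerge x y w A := by
  intro h
  have hxa : x * a * y = x := by
    obtain ⟨c, rfl⟩ := hL.1
    rw [mul_assoc c, mul_assoc c, ha]
  have hyx : y * a * x = x := by
    obtain ⟨c, rfl⟩ := hR.1
    rw [← mul_assoc, ha]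
  -- The factor `y` in the new parameters `y w_i` cancels the inserted `a`. The same identity `λₙ a
  -- y = λₙ` shows that the translated sequence merges or enters `A` only if the old one does.
  have key : ∀ n, ((mal x y w n).1 * a * y = (mal x y w n).1 ∧
      (mal x y w n).2 * a * y = (mal x y w n).2) ∧
      mal (x * a) (y * a) (fun i => y * w i) n = ((mal x y w n).1 * a, (mal x y w n).2 * a) := by
    intro n
    induction n with
    | zero => exact ⟨⟨hxa, ha⟩, rfl⟩
    | succ n ih =>
      obtain ⟨⟨h1, h2⟩, h3⟩ := ih
      simp only [mal, h3]
      refine ⟨⟨?_, ?_⟩, ?_⟩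
      · conv_rhs => rw [← h2]
        simp only [mul_assoc]
      · conv_rhs => rw [← h1]
        simp only [mul_assoc]
      · rw [← mul_assoc _ y, ← mul_assoc _ y, h1, h2]
        simp only [mul_assoc]
  obtain ⟨x', hx', y', hy', w', hw', h'⟩ := hPN (x * a) (by simpa using hS₀ 1 a x hx)
    (y * a) (by simpa using hS₀ 1 a y hy) (fun i => y * w i) A hA (fun n => by
      rw [(key n).2]
      refine ⟨fun e => (h n).1 ?_, fun e => (h n).2.1 ?_, fun e => (h n).2.2 ?_⟩
      · rw [← (key n).1.1, show (mal x y w n).1 * a = (mal x y w n).2 * a from e, (key n).1.2]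
      · rw [← (key n).1.1]; simpa using hA 1 y _ e
      · rw [← (key n).1.2]; simpa using hA 1 y _ e)
  have hc : Commute (x * a) (y * a) := by
    change x * a * (y * a) = y * a * (x * a)
    rw [← mul_assoc, hxa, ← mul_assoc, hyx]
  have hw0 : ∀ t ∈ Subsemigroup.closure {x * a, y * a}, Commute (w' 0) t := fun t ht => by
    rcases hw' 0 with e | e
    · rw [e]; exact .one_left t
    · exact commute_of_mem_closure hc e ht
  exact (h' 1).1 (mal_one_fst_eq_snd (commute_of_mem_closure hc hx' hy') (hw0 _ hx') (hw0 _ hy'))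

variable [Finite M]

/-- In a semigroup with inner sequences, a `𝓙`-class containing a never merging sequence is a
subsemigroup. -/
theorem NeverMergeIn.closedClass {S₀ : Set M} (hS₀ : IsIdealSet S₀) (hPN : HasInnerSequences S₀)
    {x y z : M} {w : ℕ → M} (hz : z ∈ S₀) (h : NeverMergeIn x y w z) : ClosedClass z := by
  have memS : ∀ t, JLe t z → t ∈ S₀ := fun t ht => hS₀.mem_of_jLe ht hz
  have hx : JEq x z := (h 0).2.1
  have hy : JEq y z := (h 0).2.2
  -- The given parameters may lie strictly above the class. Those of the inner sequence are `1` or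
  -- elements of the class itself.
  obtain ⟨x', hx', y', hy', w', hw', h'⟩ := hPN x (memS _ hx.1) y (memS _ hy.1) w _
    (isIdealSet_notAbove z) h.neverMerge
  have le : ∀ t ∈ Subsemigroup.closure {x, y}, JLe t z := fun t => jLe_of_mem_closure hx.1 hy.1
  have memJ : ∀ n, JEq (mal x' y' w' n).1 z ∧ JEq (mal x' y' w' n).2 z := fun n =>
    ⟨⟨le _ (mal_mem_of_subsemigroup hx' hy' hw' n).1, not_not.1 (h' n).2.1⟩,
      ⟨le _ (mal_mem_of_subsemigroup hx' hy' hw' n).2, not_not.1 (h' n).2.2⟩⟩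
  have prods : ∀ n, (JLe z ((mal x' y' w' n).1 * w' n) ∧ JLe z (w' n * (mal x' y' w' n).2)) ∧
      (JLe z ((mal x' y' w' n).2 * w' n) ∧ JLe z (w' n * (mal x' y' w' n).1)) := by
    intro n
    obtain ⟨h1, h2⟩ := memJ (n + 1)
    simp only [mal] at h1 h2
    refine ⟨⟨h1.2.trans (JLe.mul_left _ _), h1.2.trans ?_⟩,
      ⟨h2.2.trans (JLe.mul_left _ _), h2.2.trans ?_⟩⟩ <;>
    · rw [mul_assoc]
      exact JLe.mul_right _ _
  have hwJ : ∀ n, w' n ≠ 1 → JEq (w' n) z := fun n hn =>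
    ⟨le _ ((hw' n).resolve_left hn), (prods n).1.1.trans (JLe.mul_right _ _)⟩
  have m1 := memJ 1
  have m2 := memJ 2
  by_cases hR : REq x' y'
  · by_cases hL : LEq x' y'
    · exfalso
      obtain ⟨a, ha⟩ : ∃ a, y' * a * y' = y' := by
        refine exists_mul_mul_eq_self (t := w' 0) ((memJ 0).2.1.trans (m1.1.2.trans ?_))
        obtain ⟨c, hc⟩ := hL.1
        refine ⟨c, 1, ?_⟩
        simp only [mal, hc, mul_assoc, mul_one]
      exact not_neverMerge_of_rEq_of_lEq hS₀ hPN (isIdealSet_notAbove z) (memS _ (le _ hx'))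
        (memS _ (le _ hy')) hR hL ha h'
    -- By stability `λₙ₊₁` is 𝓛-related to `ρₙ`, and `ρₙ₊₁` to `λₙ`: the two 𝓛-classes alternate and
    -- stay different.
    · have inv : ∀ n, ¬ LEq (mal x' y' w' n).1 (mal x' y' w' n).2 := by
        intro n
        induction n with
        | zero => exact hL
        | succ n ih =>
          intro hl
          apply ih
          have h1 : LEq (mal x' y' w' (n + 1)).1 (mal x' y' w' n).2 :=
            .mul_of_jLe ((memJ n).2.1.trans (memJ (n + 1)).1.2)
          have h2 : LEq (mal x' y' w' (n + 1)).2 (mal x' y' w' n).1 :=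
            .mul_of_jLe ((memJ n).1.1.trans (memJ (n + 1)).2.2)
          exact (h2.symm.trans (hl.symm.trans h1))
      -- A nontrivial parameter serves as the common right factor `z`. If there is none, `x'` does:
      -- `ρ₁ = y' x'`, and `ρ₂ = y' x' x' y'` contains `x' x'`.
      by_cases hw1 : ∀ n, w' n = 1
      · simp only [mal, hw1, mul_one] at m1 m2
        refine closedClass_of_not_lEq hS₀ hPN hz (memJ 0).1 (memJ 0).2 (memJ 0).1 hL
          (m2.2.2.trans ⟨y', y', ?_⟩) m1.2.2
        simp only [mal, mul_assoc]
      · push Not at hw1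
        obtain ⟨n, hn⟩ := hw1
        exact closedClass_of_not_lEq hS₀ hPN hz (memJ n).1 (memJ n).2 (hwJ n hn) (inv n)
          (prods n).1.1 (prods n).2.1
  · have inv : ∀ n, REq (mal x' y' w' n).1 x' ∧ REq (mal x' y' w' n).2 y' := by
      intro n
      induction n with
      | zero => exact ⟨.refl _, .refl _⟩
      | succ n ih =>
        have h1 := memJ (n + 1)
        simp only [mal, mul_assoc] at h1 ⊢
        exact ⟨(REq.mul_of_jLe ((memJ n).1.1.trans h1.1.2)).trans ih.1,
          (REq.mul_of_jLe ((memJ n).2.1.trans h1.2.2)).trans ih.2⟩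
    by_cases hw1 : ∀ n, w' n = 1
    · simp only [mal, hw1, mul_one] at m1 m2
      refine closedClass_of_not_rEq hS₀ hPN hz (memJ 0).1 (memJ 0).2 (memJ 0).2 hR
        m1.2.2 (m2.1.2.trans ⟨x', x', ?_⟩)
      simp only [mal, mul_assoc]
    · push Not at hw1
      obtain ⟨n, hn⟩ := hw1
      exact closedClass_of_not_rEq hS₀ hPN hz (memJ n).1 (memJ n).2 (hwJ n hn)
        (fun hr => hR ((inv n).1.symm.trans (hr.trans (inv n).2))) (prods n).2.2 (prods n).1.2

-- Writing `z = u s v` in the product `z z` shows that `s (v z)` is in the class. Multiplying by `a`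
-- on the left puts `a s` in the class, and then `(a s) a` does the same for `s a`.
omit [Finite M] in
theorem ClosedClass.mul_jEq {z s a : M} (hc : ClosedClass z) (hs : JLe z s) (ha : JEq a z) :
    JEq (s * a) z ∧ JEq (a * s) z := by
  obtain ⟨u, v, huv⟩ := hs
  have h1 : JLe z (u * (s * (v * z))) := by
    have := hc z z (.refl z) (.refl z)
    nth_rw 2 [huv] at this
    simpa only [mul_assoc] using this
  have h2 : JLe z (s * (v * z)) := h1.trans (JLe.mul_right _ _)
  have h3 : JEq (s * (v * z)) z :=
    ⟨by rw [← mul_assoc]; exact JLe.mul_right _ _, h2⟩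
  have h4 : JEq (a * s) z := by
    refine ⟨(JLe.mul_left a s).trans ha.1, (hc a _ ha h3).trans ?_⟩
    rw [← mul_assoc]
    exact JLe.mul_left _ _
  refine ⟨⟨(JLe.mul_right s a).trans ha.1, (hc _ a h4 ha).trans ?_⟩, h4⟩
  rw [mul_assoc]
  exact JLe.mul_right _ _

omit [Finite M] in
theorem ClosedClass.jLe_mul {z s t : M} (hc : ClosedClass z) (hs : JLe z s) (ht : JLe z t) :
    JLe z (s * t) :=
  (hc.mul_jEq hs (hc.mul_jEq ht (.refl z)).1).1.2.trans (by
    rw [← mul_assoc]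
    exact JLe.mul_left _ _)

/-- The elements `s` and `t` act on the completely simple `𝓙`-class of `z` with values in the same
`𝓡`- and `𝓛`-classes. -/
def ActsAlike (z s t : M) : Prop := ∀ c, JEq c z → REq (s * c) (t * c) ∧ LEq (c * s) (c * t)

omit [Finite M] in
theorem ActsAlike.symm {z s t : M} (h : ActsAlike z s t) : ActsAlike z t s :=
  fun c hc => ⟨(h c hc).1.symm, (h c hc).2.symm⟩

omit [Finite M] in
theorem ActsAlike.trans {z s t r : M} (h : ActsAlike z s t) (h' : ActsAlike z t r) :
    ActsAlike z s r :=
  fun c hc => ⟨(h c hc).1.trans (h' c hc).1, (h c hc).2.trans (h' c hc).2⟩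

/-- Elements that act differently on a completely simple `𝓙`-class generate a subsemigroup with a
never merging sequence. -/
theorem exists_neverMerge_of_not_actsAlike {S₀ : Set M} (hPN : HasInnerSequences S₀) {z s t : M}
    (hc : ClosedClass z) (hs : s ∈ S₀) (ht : t ∈ S₀) (hzs : JLe z s) (hzt : JLe z t)
    (hst : ¬ ActsAlike z s t) :
    ∃ x' ∈ Subsemigroup.closure {s, t}, ∃ y' ∈ Subsemigroup.closure {s, t}, ∃ w' : ℕ → M,
      (∀ n, w' n = 1 ∨ w' n ∈ Subsemigroup.closure {s, t}) ∧
      NeverMerge x' y' w' (notAbove z) := by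
  unfold ActsAlike at hst
  push Not at hst
  obtain ⟨c, hcz, hne⟩ := hst
  -- Take all parameters equal to an element `c` that tells `s` and `t` apart. The elements above
  -- `z` are closed under products, so the sequence stays above `z`. The 𝓡-classes of `λₙ c` and `ρₙ
  -- c` are constant and the 𝓛-classes of `c λₙ` and `c ρₙ` alternate, so a difference persists.
  refine hPN s hs t ht (fun _ => c) _ (isIdealSet_notAbove z) ?_
  have above : ∀ n, JLe z (mal s t (fun _ => c) n).1 ∧ JLe z (mal s t (fun _ => c) n).2 := by
    intro n
    induction n with
    | zero => exact ⟨hzs, hzt⟩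
    | succ n ih => exact ⟨hc.jLe_mul (hc.jLe_mul ih.1 hcz.2) ih.2,
        hc.jLe_mul (hc.jLe_mul ih.2 hcz.2) ih.1⟩
  suffices ∀ n, (mal s t (fun _ => c) n).1 ≠ (mal s t (fun _ => c) n).2 from
    fun n => ⟨this n, fun h => h (above n).1, fun h => h (above n).2⟩
  by_cases hR : REq (s * c) (t * c)
  · have hL := hne hR
    have inv : ∀ n, ¬ LEq (c * (mal s t (fun _ => c) n).1) (c * (mal s t (fun _ => c) n).2) := by
      intro n
      induction n with
      | zero => exact hL
      | succ n ih =>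
        intro hl
        apply ih
        have J1 := hc.mul_jEq (above (n + 1)).1 hcz
        have J2 := hc.mul_jEq (above (n + 1)).2 hcz
        have h1 : LEq (c * (mal s t (fun _ => c) (n + 1)).1) (c * (mal s t (fun _ => c) n).2) := by
          have e : c * (mal s t (fun _ => c) (n + 1)).1 =
            c * (mal s t (fun _ => c) n).1 * (c * (mal s t (fun _ => c) n).2) := by
              simp only [mal, mul_assoc]
          rw [e] at J1 ⊢
          exact .mul_of_jLe ((hc.mul_jEq (above n).2 hcz).2.1.trans J1.2.2)
        have h2 : LEq (c * (mal s t (fun _ => c) (n + 1)).2) (c * (mal s t (fun _ => c) n).1) := by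
          have e : c * (mal s t (fun _ => c) (n + 1)).2 =
            c * (mal s t (fun _ => c) n).2 * (c * (mal s t (fun _ => c) n).1) := by
              simp only [mal, mul_assoc]
          rw [e] at J2 ⊢
          exact .mul_of_jLe ((hc.mul_jEq (above n).1 hcz).2.1.trans J2.2.2)
        exact h2.symm.trans (hl.symm.trans h1)
    exact fun n e => inv n (by rw [e]; exact .refl _)
  · have inv : ∀ n, REq ((mal s t (fun _ => c) n).1 * c) (s * c) ∧
        REq ((mal s t (fun _ => c) n).2 * c) (t * c) := by
      intro n
      induction n with
      | zero => exact ⟨.refl _, .refl _⟩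
      | succ n ih =>
        have J1 := (hc.mul_jEq (above (n + 1)).1 hcz).1
        have J2 := (hc.mul_jEq (above (n + 1)).2 hcz).1
        simp only [mal, mul_assoc _ _ c] at J1 J2 ⊢
        exact ⟨(REq.mul_of_jLe ((hc.mul_jEq (above n).1 hcz).1.1.trans J1.2)).trans ih.1,
          (REq.mul_of_jLe ((hc.mul_jEq (above n).2 hcz).1.1.trans J2.2)).trans ih.2⟩
    intro n e
    have := (inv n).1
    rw [e] at this
    exact hR (this.symm.trans (inv n).2)

/-- If `s` acts on the completely simple `𝓙`-class of `y` like `y`, then all sequences in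
`⟨s, y⟩` merge. -/
theorem not_neverMerge_of_actsAlike {S₀ : Set M} (hS₀ : IsIdealSet S₀) (hPN : HasInnerSequences S₀)
    {z s y x' y' : M} {w : ℕ → M} {A : Set M} (hA : IsIdealSet A) (hc : ClosedClass z)
    (hz : z ∈ S₀) (hzs : JLe z s) (hy : JEq y z) (hsy : ActsAlike z s y)
    (hx' : x' ∈ Subsemigroup.closure {s, y}) (hy' : y' ∈ Subsemigroup.closure {s, y})
    (hw : ∀ n, w n = 1 ∨ w n ∈ Subsemigroup.closure {s, y}) : ¬ NeverMerge x' y' w A := by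
  intro h
  have hyy := hc.mul_jEq hy.2 hy
  have hsyR : REq (s * y) y := (hsy y hy).1.trans (.mul_of_jLe (hy.1.trans hyy.1.2))
  have hysL : LEq (y * s) y := (hsy y hy).2.trans (.mul_of_jLe (hy.1.trans hyy.1.2))
  -- Each element of `⟨s, y⟩` is 𝓗-related to `y` or is a power of `s`, and the 𝓗-class absorbs the
  -- powers. So `λ₁` and `ρ₁` are both in the 𝓗-class, or all factors are powers of `s` and `λ₁ =
  -- ρ₁`.
  have hpow : ∀ m, REq m y → LEq m y → ∀ k,
      (REq (s ^ k * m) y ∧ LEq (s ^ k * m) y) ∧ (REq (m * s ^ k) y ∧ LEq (m * s ^ k) y) := by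
    intro m hR hL k
    induction k with
    | zero => simpa using ⟨hR, hL⟩
    | succ k ih =>
      obtain ⟨⟨r1, l1⟩, ⟨r2, l2⟩⟩ := ih
      have j1 := hc.mul_jEq hzs (r1.jEq.trans hy)
      have j2 := hc.mul_jEq hzs (r2.jEq.trans hy)
      rw [show s ^ (k + 1) * m = s * (s ^ k * m) by rw [pow_succ', mul_assoc],
        show m * s ^ (k + 1) = m * s ^ k * s by rw [pow_succ, mul_assoc]]
      exact ⟨⟨(r1.mul_left s).trans hsyR,
          (LEq.mul_of_jLe ((r1.jEq.trans hy).1.trans j1.1.2)).trans l1⟩,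
        ⟨(REq.mul_of_jLe ((r2.jEq.trans hy).1.trans j2.2.2)).trans r2,
          (l2.mul_right s).trans hysL⟩⟩
  have hmul : ∀ a b, ((REq a y ∧ LEq a y) ∨ ∃ k, a = s ^ k) →
      ((REq b y ∧ LEq b y) ∨ ∃ k, b = s ^ k) →
      ((REq a y ∧ LEq a y) ∨ (REq b y ∧ LEq b y)) → (REq (a * b) y ∧ LEq (a * b) y) := by
    rintro a b (ha | ⟨k, rfl⟩) (hb | ⟨l, rfl⟩) hab
    · have j := hc a b (ha.1.jEq.trans hy) (hb.1.jEq.trans hy)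
      exact ⟨(REq.mul_of_jLe ((ha.1.jEq.trans hy).1.trans j)).trans ha.1,
        (LEq.mul_of_jLe ((hb.1.jEq.trans hy).1.trans j)).trans hb.2⟩
    · exact (hpow a ha.1 ha.2 l).2
    · exact (hpow b hb.1 hb.2 k).1
    · rcases hab with ha | hb
      · exact (hpow _ ha.1 ha.2 l).2
      · exact (hpow _ hb.1 hb.2 k).1
  have hmul' : ∀ a b, ((REq a y ∧ LEq a y) ∨ ∃ k, a = s ^ k) →
      ((REq b y ∧ LEq b y) ∨ ∃ k, b = s ^ k) →
      ((REq (a * b) y ∧ LEq (a * b) y) ∨ ∃ k, a * b = s ^ k) := by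
    intro a b ha hb
    by_cases hab : (REq a y ∧ LEq a y) ∨ (REq b y ∧ LEq b y)
    · exact .inl (hmul a b ha hb hab)
    · rw [not_or] at hab
      obtain ⟨k, rfl⟩ := ha.resolve_left hab.1
      obtain ⟨l, rfl⟩ := hb.resolve_left hab.2
      exact .inr ⟨k + l, (pow_add _ _ _).symm⟩
  have cases : ∀ m, m ∈ Subsemigroup.closure {s, y} → (REq m y ∧ LEq m y) ∨ ∃ k, m = s ^ k := by
    intro m hm
    induction hm using Subsemigroup.closure_induction with
    | mem m hm =>
      rcases hm with rfl | rfl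
      · exact .inr ⟨1, (pow_one _).symm⟩
      · exact .inl ⟨.refl _, .refl _⟩
    | mul a b _ _ iha ihb => exact hmul' a b iha ihb
  have hw0 : (REq (w 0) y ∧ LEq (w 0) y) ∨ ∃ k, w 0 = s ^ k := by
    rcases hw 0 with e | e
    · exact .inr ⟨0, by rw [e, pow_zero]⟩
    · exact cases _ e
  have cx := cases _ hx'
  have cy := cases _ hy'
  have hH : (REq (x' * w 0 * y') y ∧ LEq (x' * w 0 * y') y) ∧
      (REq (y' * w 0 * x') y ∧ LEq (y' * w 0 * x') y) := by
    by_cases hx : REq x' y ∧ LEq x' y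
    · exact ⟨hmul _ _ (hmul' _ _ cx hw0) cy (.inl (hmul _ _ cx hw0 (.inl hx))),
        hmul _ _ (hmul' _ _ cy hw0) cx (.inr hx)⟩
    by_cases hyH : REq y' y ∧ LEq y' y
    · exact ⟨hmul _ _ (hmul' _ _ cx hw0) cy (.inr hyH),
        hmul _ _ (hmul' _ _ cy hw0) cx (.inl (hmul _ _ cy hw0 (.inl hyH)))⟩
    by_cases hwH : REq (w 0) y ∧ LEq (w 0) y
    · exact ⟨hmul _ _ (hmul' _ _ cx hw0) cy (.inl (hmul _ _ cx hw0 (.inr hwH))),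
        hmul _ _ (hmul' _ _ cy hw0) cx (.inl (hmul _ _ cy hw0 (.inr hwH)))⟩
    exfalso
    obtain ⟨a, rfl⟩ := cx.resolve_left hx
    obtain ⟨b, rfl⟩ := cy.resolve_left hyH
    obtain ⟨c, hcw⟩ := hw0.resolve_left hwH
    refine (h 1).1 (mal_one_fst_eq_snd (Commute.pow_pow_self _ _ _) ?_ ?_) <;>
    · rw [hcw]
      exact Commute.pow_pow_self _ _ _
  have j2 := hH.2.1.jEq.trans hy
  obtain ⟨a, ha⟩ : ∃ a, (y' * w 0 * x') * a * (y' * w 0 * x') = y' * w 0 * x' :=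
    exists_mul_mul_eq_self (t := 1) (by rw [mul_one]; exact j2.1.trans (hc _ _ j2 j2))
  exact not_neverMerge_of_rEq_of_lEq hS₀ hPN hA (hS₀.mem_of_jLe (hH.1.1.jEq.trans hy).1 hz)
    (hS₀.mem_of_jLe j2.1 hz) (hH.1.1.trans hH.2.1.symm) (hH.1.2.trans hH.2.2.symm) ha (h.shift 1)

/-- In a closed class `x x 𝓡 x` and `y x 𝓡 y`, and dually for 𝓛. Acting alike would therefore make
`x` and `y` 𝓗-related, which excludes a never merging sequence. -/
theorem NeverMergeIn.not_actsAlike {S₀ : Set M} (hS₀ : IsIdealSet S₀) (hPN : HasInnerSequences S₀)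
    {x y z : M} {w : ℕ → M} (hz : z ∈ S₀) (h : NeverMergeIn x y w z) : ¬ ActsAlike z x y := by
  intro ha
  have hc := h.closedClass hS₀ hPN hz
  have hx : JEq x z := (h 0).2.1
  have hy : JEq y z := (h 0).2.2
  have hR : REq x y := by
    have h1 : REq (x * x) x := .mul_of_jLe (hx.1.trans (hc x x hx hx))
    have h2 : REq (y * x) y := .mul_of_jLe (hy.1.trans (hc y x hy hx))
    exact h1.symm.trans ((ha x hx).1.trans h2)
  have hL : LEq x y := by
    have h1 : LEq (x * x) x := .mul_of_jLe (hx.1.trans (hc x x hx hx))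
    have h2 : LEq (x * y) y := .mul_of_jLe (hy.1.trans (hc x y hx hy))
    exact h1.symm.trans ((ha x hx).2.trans h2)
  obtain ⟨a, ha⟩ : ∃ a, y * a * y = y :=
    exists_mul_mul_eq_self (t := 1) (by rw [mul_one]; exact hy.1.trans (hc _ _ hy hy))
  exact not_neverMerge_of_rEq_of_lEq hS₀ hPN (isIdealSet_notAbove z) (hS₀.mem_of_jLe hx.1 hz)
    (hS₀.mem_of_jLe hy.1 hz) hR hL ha h.neverMerge

end Structure

/-! ### Nilpotency and never merging sequences -/

section Bridge

/-- The subset `U` of a monoid contains the data of a Mal'cev sequence that never merges modulo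
the ideal `A`. -/
def HasSeq {M : Type*} [Monoid M] (U A : Set M) : Prop :=
  ∃ x ∈ U, ∃ y ∈ U, ∃ w : ℕ → M, (∀ n, w n = 1 ∨ w n ∈ U) ∧ NeverMerge x y w A

theorem HasSeq.mono {M : Type*} [Monoid M] {U V A B : Set M} (h : HasSeq U A) (hU : U ⊆ V)
    (hA : B ⊆ A) : HasSeq V B := by
  obtain ⟨x, hx, y, hy, w, hw, h⟩ := h
  exact ⟨x, hU hx, y, hU hy, w, fun n => (hw n).imp_right fun h => hU h,
    fun n => ⟨(h n).1, fun h' => (h n).2.1 (hA h'), fun h' => (h n).2.2 (hA h')⟩⟩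

theorem malcev_map {U Q : Type*} [Mul U] [Mul Q] (g : U →ₙ* Q) (x y : U) (c : ℕ → Option U)
    (n : ℕ) : malcev (g x) (g y) (fun i => (c i).map g) n =
      (g (malcev x y c n).1, g (malcev x y c n).2) := by
  induction n with
  | zero => rfl
  | succ n ih => cases h : c n <;> simp [malcev, ih, mid, h]

theorem mal_map {U M : Type*} [Mul U] [Monoid M] (j : U →ₙ* M) (x y : U) (c : ℕ → Option U)
    (n : ℕ) : mal (j x) (j y) (fun i => (c i).elim 1 j) n =
      (j (malcev x y c n).1, j (malcev x y c n).2) := by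
  induction n with
  | zero => rfl
  | succ n ih => cases h : c n <;> simp [mal, malcev, ih, mid, h]

theorem mal_fst_eq_snd_of_le {M : Type*} [Monoid M] {x y : M} {w : ℕ → M} {n m : ℕ}
    (h : (mal x y w n).1 = (mal x y w n).2) (hnm : n ≤ m) :
    (mal x y w m).1 = (mal x y w m).2 := by
  induction m, hnm using Nat.le_induction with
  | base => exact h
  | succ m _ ih => simp only [mal, ih]

theorem exists_mal_eq {M : Type*} [Monoid M] [Finite M] (x y : M) (w : ℕ → M) :
    ∃ s p, s + (p + 1) ≤ Nat.card (M × M) ∧ mal x y w s = mal x y w (s + (p + 1)) := by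
  obtain ⟨i, j, hij, h⟩ : ∃ i j : Fin (Nat.card (M × M) + 1), i < j ∧
      mal x y w i = mal x y w j := by
    by_contra! hcon
    have : Function.Injective fun i : Fin (Nat.card (M × M) + 1) => mal x y w i := by
      intro i j hij
      rcases lt_trichotomy i j with h | h | h
      · exact absurd hij (hcon i j h)
      · exact h
      · exact absurd hij.symm (hcon j i h)
    have := Nat.card_le_card_of_injective _ this
    simp at this
  have h1 : (i : ℕ) < j := hij
  have h2 : (j : ℕ) = i + (j - i - 1 + 1) := by omega
  exact ⟨i, j - i - 1, by omega, by rw [← h2]; exact h⟩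

/-- Once a pair recurs, repeating the parameters of the loop periodically makes the sequence run
round it forever. -/
theorem mal_loop {M : Type*} [Monoid M] {x y : M} {w : ℕ → M} {s p : ℕ}
    (h : mal x y w s = mal x y w (s + (p + 1))) (i : ℕ) :
    mal (mal x y w s).1 (mal x y w s).2 (fun i => w (s + i % (p + 1))) i =
      mal x y w (s + i % (p + 1)) := by
  induction i with
  | zero => rw [Nat.zero_mod]; rfl
  | succ i ih =>
    have hs : mal (mal x y w s).1 (mal x y w s).2 (fun i => w (s + i % (p + 1))) (i + 1) =
        mal x y w (s + i % (p + 1) + 1) := by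
      rw [mal, mal, ih]
    rw [hs, ← Nat.mod_add_mod i (p + 1) 1, add_assoc]
    rcases Nat.lt_or_ge (i % (p + 1) + 1) (p + 1) with hlt | hge
    · rw [Nat.mod_eq_of_lt hlt]
    · have e : i % (p + 1) + 1 = p + 1 := le_antisymm (Nat.mod_lt i p.succ_pos) hge
      rw [e, Nat.mod_self, ← h, add_zero]

theorem mal_mem_of_mem {M : Type*} [Monoid M] {x y : M} {w : ℕ → M} {A : Set M}
    (hA : IsIdealSet A) {n m : ℕ} (hnm : n < m) (h : (mal x y w n).1 ∈ A ∨ (mal x y w n).2 ∈ A) :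
    (mal x y w m).1 ∈ A ∧ (mal x y w m).2 ∈ A := by
  obtain ⟨⟨h1, h2⟩, ⟨h3, h4⟩⟩ := mal_jLe_of_lt x y w hnm
  rcases h with h | h
  · exact ⟨hA.mem_of_jLe h1 h, hA.mem_of_jLe h3 h⟩
  · exact ⟨hA.mem_of_jLe h2 h, hA.mem_of_jLe h4 h⟩

/-- A Mal'cev sequence that does not merge for a long time contains a loop. -/
theorem exists_neverMerge_of_forall_le {M : Type*} [Monoid M] [Finite M] {x y : M} {w : ℕ → M}
    {A : Set M} (hA : IsIdealSet A) (h : ∀ k ≤ Nat.card (M × M),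
      (mal x y w k).1 ≠ (mal x y w k).2 ∧ ¬ ((mal x y w k).1 ∈ A ∧ (mal x y w k).2 ∈ A)) :
    ∃ s p, NeverMerge (mal x y w s).1 (mal x y w s).2 (fun i => w (s + i % (p + 1))) A := by
  obtain ⟨s, p, hsp, he⟩ := exists_mal_eq x y w
  refine ⟨s, p, fun n => ?_⟩
  rw [mal_loop he]
  have hlt : s + n % (p + 1) < s + (p + 1) := by
    have : n % (p + 1) < p + 1 := Nat.mod_lt n p.succ_pos
    omega
  -- A single term in `A` pulls both terms into `A` at every later step, so no term of the loop
  -- before its end can meet `A`.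
  have hend := (h _ hsp).2
  refine ⟨(h _ (hlt.le.trans hsp)).1, fun hc => hend (mal_mem_of_mem hA hlt (.inl hc)),
    fun hc => hend (mal_mem_of_mem hA hlt (.inr hc))⟩

/-- This is stated for a Rees-type quotient `Q` of a semigroup `U` embedded in `M`, so that it
covers ideals, principal factors and two-generated subsemigroups of Rees quotients alike. -/
theorem not_isNilp_iff {U Q M : Type*} [Mul U] [Mul Q] [Monoid M] [Finite M] (g : U →ₙ* Q)
    (hg : Function.Surjective g) (j : U →ₙ* M) (hj : Function.Injective j) {A : Set M}
    (hA : IsIdealSet A) (hker : ∀ a b, g a = g b ↔ a = b ∨ (j a ∈ A ∧ j b ∈ A)) :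
    ¬ IsNilp Q ↔ HasSeq (Set.range j) A := by
  have lift_seq : ∀ c : ℕ → Option Q, ∃ c' : ℕ → Option U, ∀ i, (c' i).map g = c i := by
    intro c
    have : ∀ i, ∃ d : Option U, d.map g = c i := by
      intro i
      cases h : c i with
      | none => exact ⟨none, rfl⟩
      | some q =>
        obtain ⟨u, rfl⟩ := hg q
        exact ⟨some u, rfl⟩
    choose c' hc' using this
    exact ⟨c', hc'⟩
  constructor
  · intro h
    unfold IsNilp at h
    push Not at h
    -- The extra step leaves every index up to the pigeonhole bound strictly before the unmerged
    -- end.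
    obtain ⟨a, b, c, hne⟩ := h (Nat.card (M × M) + 1) (by omega)
    obtain ⟨a, rfl⟩ := hg a
    obtain ⟨b, rfl⟩ := hg b
    obtain ⟨c', hc'⟩ := lift_seq c
    obtain rfl : (fun i => (c' i).map g) = c := funext hc'
    rw [malcev_map, Ne, hker, not_or] at hne
    have hlast : (mal (j a) (j b) (fun i => (c' i).elim 1 j) (Nat.card (M × M) + 1)).1 ≠
        (mal (j a) (j b) (fun i => (c' i).elim 1 j) (Nat.card (M × M) + 1)).2 := by
      rw [mal_map]
      exact fun e => hne.1 (hj e)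
    have hmem : ∀ n, (mal (j a) (j b) (fun i => (c' i).elim 1 j) n).1 ∈ Set.range j ∧
        (mal (j a) (j b) (fun i => (c' i).elim 1 j) n).2 ∈ Set.range j := by
      intro n
      rw [mal_map]
      exact ⟨⟨_, rfl⟩, ⟨_, rfl⟩⟩
    obtain ⟨s, p, hs⟩ := exists_neverMerge_of_forall_le (x := j a) (y := j b)
      (w := fun i => (c' i).elim 1 j) hA (fun k hk => by
        have hk' : k < Nat.card (M × M) + 1 := by omega
        refine ⟨fun e => hlast ?_, fun e => hne.2 ?_⟩
        · have := mal_fst_eq_snd_of_le e hk'.le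
          exact this
        · have := mal_mem_of_mem hA hk' (.inl e.1)
          rwa [mal_map] at this)
    refine ⟨_, (hmem s).1, _, (hmem s).2, _, fun n => ?_, hs⟩
    cases h : c' (s + n % (p + 1)) with
    | none => exact .inl (by simp only [Option.elim])
    | some u => exact .inr ⟨u, by simp only [Option.elim]⟩
  · rintro ⟨_, ⟨a, rfl⟩, _, ⟨b, rfl⟩, w, hw, h⟩ ⟨n, -, hn⟩
    have : ∀ i, ∃ d : Option U, d.elim 1 j = w i := by
      intro i
      rcases hw i with e | ⟨u, hu⟩
      · exact ⟨none, e.symm⟩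
      · exact ⟨some u, hu⟩
    choose c hc using this
    obtain rfl : (fun i => (c i).elim 1 j) = w := funext hc
    have h1 := hn (g a) (g b) (fun i => (c i).map g)
    have h2 := h n
    rw [malcev_map, hker] at h1
    rw [mal_map] at h2
    rcases h1 with h1 | h1
    · exact h2.1 (congrArg j h1)
    · exact h2.2.1 h1.1

/-! ### Transfer of adjacency and nilpotency to `S¹` -/

variable {S : Type*} [Semigroup S]

instance [Finite S] : Finite (WithOne S) := inferInstanceAs (Finite (Option S))

theorem isIdealSet_range_coe : IsIdealSet (Set.range ((↑) : S → WithOne S)) := by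
  rintro a b _ ⟨s, rfl⟩
  induction a with
  | one => induction b with
    | one => exact ⟨s, by simp⟩
    | coe b => exact ⟨s * b, by rw [one_mul, WithOne.coe_mul]⟩
  | coe a => induction b with
    | one => exact ⟨a * s, by rw [mul_one, WithOne.coe_mul]⟩
    | coe b => exact ⟨a * s * b, by rw [WithOne.coe_mul, WithOne.coe_mul]⟩

/-- The ideal `I` as a subset of `S¹`. -/
def SIdeal.toSet (I : SIdeal S) : Set (WithOne S) := (↑) '' (I : Set S)

theorem SIdeal.coe_mem_toSet {I : SIdeal S} {s : S} : (s : WithOne S) ∈ I.toSet ↔ s ∈ I := by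
  constructor
  · rintro ⟨t, ht, e⟩
    rw [← WithOne.coe_inj.1 e]
    exact ht
  · exact fun h => ⟨s, h, rfl⟩

theorem SIdeal.isIdealSet_toSet (I : SIdeal S) : IsIdealSet I.toSet := by
  rintro a b _ ⟨s, hs, rfl⟩
  induction a with
  | one => induction b with
    | one => exact ⟨s, hs, by simp⟩
    | coe b => exact ⟨s * b, I.mul_mem_right _ hs, by rw [one_mul, WithOne.coe_mul]⟩
  | coe a => induction b with
    | one => exact ⟨a * s, I.mul_mem_left _ hs, by rw [mul_one, WithOne.coe_mul]⟩
    | coe b => exact ⟨a * s * b, I.mul_mem_right _ (I.mul_mem_left _ hs),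
        by rw [WithOne.coe_mul, WithOne.coe_mul]⟩

theorem closure_pair_coe (x y : S) :
    (Subsemigroup.closure {(x : WithOne S), (y : WithOne S)} : Set (WithOne S)) =
      (↑) '' (Subsemigroup.closure {x, y} : Set S) := by
  have := WithOne.coeMulHom.map_mclosure ({x, y} : Set S)
  rw [Set.image_pair] at this
  exact (congrArg (fun U : Subsemigroup (WithOne S) => (U : Set (WithOne S))) this).symm

/-- Adjacency of the images of `x` and `y` in a Rees quotient. -/
theorem adj_map_iff {T R : Type*} [Semigroup T] [Mul R] [Finite S] (j : T →ₙ* S)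
    (hj : Function.Injective j) (f : T →ₙ* R) {A : Set (WithOne S)} (hA : IsIdealSet A)
    (hf : ∀ a b, f a = f b ↔ a = b ∨ (((j a : S) : WithOne S) ∈ A ∧ ((j b : S) : WithOne S) ∈ A))
    (x y : T) :
    (nonNilGraph R).Adj (f x) (f y) ↔ f x ≠ f y ∧
      HasSeq (Subsemigroup.closure {((j x : S) : WithOne S), ((j y : S) : WithOne S)}) A := by
  refine and_congr_right fun _ => ?_
  have e : Subsemigroup.closure {f x, f y} = (Subsemigroup.closure {x, y}).map f := by
    rw [MulHom.map_mclosure, Set.image_pair]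
  rw [e]
  let i : Subsemigroup.closure {x, y} →ₙ* WithOne S :=
    (WithOne.coeMulHom.comp j).comp (MulMemClass.subtype (Subsemigroup.closure {x, y}))
  rw [not_isNilp_iff (f.subsemigroupMap (Subsemigroup.closure {x, y}))
    (f.subsemigroupMap_surjective _) i
    (fun a b hab => Subtype.ext (hj (WithOne.coe_inj.1 hab))) hA (fun a b => by
      rw [Subtype.ext_iff, Subtype.ext_iff]
      exact hf a b)]
  have e2 : Set.range i =
      (Subsemigroup.closure {((j x : S) : WithOne S), ((j y : S) : WithOne S)} :
        Set (WithOne S)) := by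
    rw [closure_pair_coe]
    have := j.map_mclosure ({x, y} : Set T)
    rw [Set.image_pair] at this
    rw [← this]
    ext m
    constructor
    · rintro ⟨a, rfl⟩
      exact ⟨_, ⟨a, a.2, rfl⟩, rfl⟩
    · rintro ⟨_, ⟨a, ha, rfl⟩, rfl⟩
      exact ⟨⟨a, ha⟩, rfl⟩
  rw [e2]

theorem SIdeal.con_coe_eq_iff {T : Type*} [Mul T] (I : SIdeal T) (a b : T) :
    ((a : I.con.Quotient) = (b : I.con.Quotient)) ↔ a = b ∨ (a ∈ I ∧ b ∈ I) :=
  I.con.eq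

/-- Finite pseudo-nilpotent semigroups have inner sequences. -/
theorem IsPseudoNilpotent.hasInnerSequences [Finite S] (h : IsPseudoNilpotent S) :
    HasInnerSequences (Set.range ((↑) : S → WithOne S)) := by
  rintro _ ⟨x, rfl⟩ _ ⟨y, rfl⟩ w A hA hNM
  obtain ⟨c, rfl⟩ : ∃ c : ℕ → Option S, (fun i => (c i).elim 1 WithOne.coeMulHom) = w := by
    have : ∀ i, ∃ d : Option S, d.elim 1 WithOne.coeMulHom = w i := by
      intro i
      cases w i with
      | one => exact ⟨none, rfl⟩
      | coe s => exact ⟨some s, rfl⟩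
    choose c hc using this
    exact ⟨c, funext hc⟩
  have hmal := mal_map WithOne.coeMulHom x y c
  obtain ⟨t, p, -, hp⟩ := exists_mal_eq (x : WithOne S) y
    (fun i => (c i).elim 1 WithOne.coeMulHom)
  have hne : (malcev x y c t).1 ≠ (malcev x y c t).2 := by
    intro e
    have := (hNM t).1
    erw [hmal] at this
    exact this (congrArg _ e)
  have heq : malcev x y c t = malcev x y c (t + (p + 1)) := by
    erw [hmal, hmal] at hp
    rw [Prod.mk.injEq] at hp
    exact Prod.ext (WithOne.coe_inj.1 hp.1) (WithOne.coe_inj.1 hp.2)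
  set m := t + (p + 1) with hm
  have hcoe : ∀ (a : genSub x y c m), ((a : S) : WithOne S) ∈ A ↔ a ∈
      ({carrier := {a | ((a : S) : WithOne S) ∈ A}
        mul_mem_left := fun s a ha => by simpa using hA (s : S) 1 _ ha
        mul_mem_right := fun s a ha => by simpa using hA 1 (s : S) _ ha} :
        SIdeal (genSub x y c m)) := fun a => Iff.rfl
  generalize ({carrier := {a | ((a : S) : WithOne S) ∈ A}
               mul_mem_left := fun s a ha => by simpa using hA (s : S) 1 _ ha
               mul_mem_right := fun s a ha => by simpa using hA 1 (s : S) _ ha} :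
        SIdeal (genSub x y c m)) = I at hcoe
  have hlast := hNM m
  erw [hmal] at hlast
  -- Here `I` is the trace of `A` on the generated subsemigroup. Index `0` is enough: it says that
  -- `x` and `y` themselves are adjacent modulo `I`.
  have hadj := h x y c t m (by omega) hne heq I (fun hl => hlast.2.1 ((hcoe _).2 hl))
    (fun hl => hlast.2.2 ((hcoe _).2 hl)) 0 (Nat.zero_le _)
  let f : genSub x y c m →ₙ* I.Quot := ⟨fun a => (a : I.con.Quotient), fun _ _ => rfl⟩
  exact ((adj_map_iff (MulMemClass.subtype (genSub x y c m)) Subtype.coe_injective f hA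
    (fun a b => (I.con_coe_eq_iff a b).trans (by rw [← hcoe, ← hcoe]; rfl)) _ _).1 hadj).2

theorem adj_iff [Finite S] {x y : S} : (nonNilGraph S).Adj x y ↔ x ≠ y ∧
    HasSeq (Subsemigroup.closure {(x : WithOne S), (y : WithOne S)} : Set (WithOne S)) ∅ :=
  adj_map_iff (MulHom.id S) Function.injective_id (MulHom.id S) (fun _ _ _ h => h.elim)
    (fun a b => by simp) x y

theorem SIdeal.toQuotZero_eq_iff (I : SIdeal S) (a b : S) :
    I.toQuotZero a = I.toQuotZero b ↔ a = b ∨ (a ∈ I ∧ b ∈ I) := by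
  have key : ∀ s : S, (s : WithZero S) ∈ I.adjoinZero ↔ s ∈ I := fun s =>
    ⟨fun h => h s rfl, fun h t ht => by rwa [← WithZero.coe_inj.1 ht]⟩
  exact (I.adjoinZero.con_coe_eq_iff (a : WithZero S) b).trans
    (or_congr WithZero.coe_inj (and_congr (key a) (key b)))

theorem SIdeal.toQuotZero_eq_zero_iff (I : SIdeal S) (a : S) : I.toQuotZero a = 0 ↔ a ∈ I := by
  have key : ∀ s : S, (s : WithZero S) ∈ I.adjoinZero ↔ s ∈ I := fun s =>
    ⟨fun h => h s rfl, fun h t ht => by rwa [← WithZero.coe_inj.1 ht]⟩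
  rw [← key]
  refine (I.adjoinZero.con_coe_eq_iff _ _).trans ⟨?_, fun h => .inr ⟨h, fun t ht => ?_⟩⟩
  · rintro (h | h)
    · exact absurd h (by simp)
    · exact h.1
  · exact absurd ht (by simp)

theorem SIdeal.toQuotZero_mul (I : SIdeal S) (a b : S) :
    I.toQuotZero (a * b) = I.toQuotZero a * I.toQuotZero b := rfl

theorem adj_toQuotZero_iff [Finite S] (I : SIdeal S) {x y : S} :
    (nonNilGraph I.QuotZero).Adj (I.toQuotZero x) (I.toQuotZero y) ↔
      I.toQuotZero x ≠ I.toQuotZero y ∧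
      HasSeq (Subsemigroup.closure {(x : WithOne S), (y : WithOne S)}) I.toSet :=
  adj_map_iff (MulHom.id S) Function.injective_id ⟨I.toQuotZero, I.toQuotZero_mul⟩
    I.isIdealSet_toSet (fun a b => by
      rw [MulHom.id_apply, MulHom.id_apply, SIdeal.coe_mem_toSet, SIdeal.coe_mem_toSet]
      exact I.toQuotZero_eq_iff a b) x y

theorem not_isNilp_toSub_iff [Finite S] (I : SIdeal S) : ¬ IsNilp I.toSub ↔ HasSeq I.toSet ∅ := by
  rw [not_isNilp_iff (MulHom.id I.toSub) Function.surjective_id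
    (WithOne.coeMulHom.comp (MulMemClass.subtype I.toSub))
    (fun a b hab => Subtype.ext (WithOne.coe_inj.1 hab)) (A := ∅) (fun _ _ _ h => h.elim)
    (fun a b => by simp)]
  have : Set.range (WithOne.coeMulHom.comp (MulMemClass.subtype I.toSub)) = I.toSet := by
    ext m
    constructor
    · rintro ⟨a, rfl⟩
      exact ⟨a, a.2, rfl⟩
    · rintro ⟨a, ha, rfl⟩
      exact ⟨⟨a, ha⟩, rfl⟩
  rw [this]

theorem PrincipalSeries.not_factorNilp_iff [Finite S] (σ : PrincipalSeries S) (i : Fin σ.m) :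
    ¬ σ.FactorNilp i ↔ HasSeq (σ.top i).toSet (σ.bot i).toSet := by
  let f : (σ.top i).toSub →ₙ* ((σ.bot i).restrict (σ.top i).toSub).Quot :=
    ⟨fun a => (a : ((σ.bot i).restrict (σ.top i).toSub).con.Quotient), fun _ _ => rfl⟩
  refine (not_isNilp_iff f (fun q => Quotient.exists_rep q)
    (WithOne.coeMulHom.comp (MulMemClass.subtype (σ.top i).toSub))
    (fun a b hab => Subtype.ext (WithOne.coe_inj.1 hab)) (σ.bot i).isIdealSet_toSet
    (fun a b => (SIdeal.con_coe_eq_iff _ a b).trans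
      (or_congr_right (and_congr (SIdeal.coe_mem_toSet (s := (a : S))).symm
        (SIdeal.coe_mem_toSet (s := (b : S))).symm)))).trans ?_
  have : Set.range (WithOne.coeMulHom.comp (MulMemClass.subtype (σ.top i).toSub)) =
      (σ.top i).toSet := by
    ext m
    constructor
    · rintro ⟨a, rfl⟩
      exact ⟨a, a.2, rfl⟩
    · rintro ⟨a, ha, rfl⟩
      exact ⟨⟨a, ha⟩, rfl⟩
  rw [this]

end Bridge

/-! ### Cores: the non-nilpotent principal factors -/

section Core

theorem eq_pow_or_jLe {M : Type*} [Monoid M] {x y m : M}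
    (hm : m = 1 ∨ m ∈ Subsemigroup.closure {x, y}) : JLe m x ∨ ∃ k : ℕ, m = y ^ k := by
  rcases hm with rfl | hm
  · exact .inr ⟨0, (pow_zero y).symm⟩
  induction hm using Subsemigroup.closure_induction with
  | mem m hm =>
    rcases hm with rfl | rfl
    · exact .inl (.refl _)
    · exact .inr ⟨1, (pow_one _).symm⟩
  | mul a b _ _ iha ihb =>
    rcases iha with iha | ⟨k, rfl⟩
    · exact .inl ((JLe.mul_left a b).trans iha)
    rcases ihb with ihb | ⟨l, rfl⟩
    · exact .inl ((JLe.mul_right _ b).trans ihb)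
    · exact .inr ⟨k + l, (pow_add y k l).symm⟩

/-- If none of the three factors involved `x`, they would be powers of `y`, commute, and merge at
once. -/
theorem mal_one_jLe {M : Type*} [Monoid M] {x y x' y' : M} {w : ℕ → M} {A : Set M}
    (hx' : x' ∈ Subsemigroup.closure {x, y}) (hy' : y' ∈ Subsemigroup.closure {x, y})
    (hw : w 0 = 1 ∨ w 0 ∈ Subsemigroup.closure {x, y}) (h : NeverMerge x' y' w A) :
    JLe (mal x' y' w 1).1 x := by
  change JLe (x' * w 0 * y') x
  rcases eq_pow_or_jLe (.inr hx') with h1 | ⟨a, ha⟩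
  · exact ((JLe.mul_left _ _).trans (JLe.mul_left _ _)).trans h1
  rcases eq_pow_or_jLe (.inr hy') with h2 | ⟨b, hb⟩
  · exact (JLe.mul_right _ _).trans h2
  rcases eq_pow_or_jLe hw with h3 | ⟨c, hc⟩
  · exact ((JLe.mul_left _ _).trans (JLe.mul_right _ _)).trans h3
  refine absurd (mal_one_fst_eq_snd ?_ ?_ ?_) (h 1).1
  · rw [ha, hb]; exact Commute.pow_pow_self _ _ _
  · rw [hc, ha]; exact Commute.pow_pow_self _ _ _
  · rw [hc, hb]; exact Commute.pow_pow_self _ _ _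

variable {S : Type*} [Semigroup S]

/-- The `𝓙`-class of `z` contains a never merging Mal'cev sequence. -/
def IsCore (z : S) : Prop := ∃ x y w, NeverMergeIn x y w (z : WithOne S)

/-- `z` lies in a minimal `𝓙`-class that contains a never merging Mal'cev sequence. -/
def IsMinCore (z : S) : Prop :=
  IsCore z ∧ ∀ t : S, IsCore t → JLe (t : WithOne S) z → JLe (z : WithOne S) t

theorem SIdeal.mem_of_jLe (I : SIdeal S) {s t : S} (h : JLe (s : WithOne S) t) (ht : t ∈ I) :
    s ∈ I :=
  SIdeal.coe_mem_toSet.1 (I.isIdealSet_toSet.mem_of_jLe h (SIdeal.coe_mem_toSet.2 ht))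

theorem exists_coe_eq_of_jLe {m : WithOne S} {s : S} (h : JLe m s) : ∃ t : S, (t : WithOne S) = m :=
  isIdealSet_range_coe.mem_of_jLe h ⟨s, rfl⟩

theorem exists_isMinCore [Finite S] {z : S} (hz : IsCore z) :
    ∃ t : S, IsMinCore t ∧ JLe (t : WithOne S) z := by
  obtain ⟨t, ⟨htc, htz⟩, hmin⟩ := Set.Finite.exists_minimalFor
    (fun t : S => {u : S | JLe (u : WithOne S) t}) {t : S | IsCore t ∧ JLe (t : WithOne S) z}
    (Set.toFinite _) ⟨z, hz, .refl _⟩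
  exact ⟨t, ⟨htc, fun u hu hut => hmin ⟨hu, hut.trans htz⟩ (fun v hv => JLe.trans hv hut)
    (JLe.refl (t : WithOne S))⟩, htz⟩

theorem exists_isCore_of_hasSeq_ideal [Finite S] {I : SIdeal S} {A : Set (WithOne S)}
    (h : HasSeq I.toSet A) : ∃ z ∈ I, IsCore z := by
  obtain ⟨x, ⟨x, hx, rfl⟩, y, -, w, -, h⟩ := h
  obtain ⟨N, hNx, -, hN⟩ := h.exists_neverMergeIn
  obtain ⟨z, hz⟩ := exists_coe_eq_of_jLe hNx
  rw [← hz] at hNx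
  exact ⟨z, I.mem_of_jLe hNx hx, _, _, _, hz ▸ hN⟩

theorem exists_isCore_of_hasSeq_closure [Finite S] {x y : S} {A : Set (WithOne S)}
    (h : HasSeq (Subsemigroup.closure {(x : WithOne S), (y : WithOne S)} : Set (WithOne S)) A) :
    ∃ z : S, IsCore z ∧ JLe (z : WithOne S) x ∧ JLe (z : WithOne S) y := by
  obtain ⟨x', hx', y', hy', w, hw, h⟩ := h
  have h1 := mal_one_jLe hx' hy' (hw 0) h
  have h2 : JLe (mal x' y' w 1).1 (y : WithOne S) := by
    rw [Set.pair_comm] at hx' hy' hw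
    exact mal_one_jLe hx' hy' (hw 0) h
  obtain ⟨N, hN1, -, hN⟩ := (h.shift 1).exists_neverMergeIn
  obtain ⟨z, hz⟩ := exists_coe_eq_of_jLe (hN1.trans h1)
  refine ⟨z, ⟨_, _, _, hz ▸ hN⟩, ?_, ?_⟩
  · rw [hz]; exact hN1.trans h1
  · rw [hz]; exact hN1.trans h2

theorem IsCore.closedClass [Finite S] (hP : HasInnerSequences (Set.range ((↑) : S → WithOne S)))
    {z : S} (hz : IsCore z) : ClosedClass (z : WithOne S) := by
  obtain ⟨x, y, w, h⟩ := hz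
  exact h.closedClass isIdealSet_range_coe hP ⟨z, rfl⟩

/-- The parameters of a core are arbitrary elements of `S¹`; inner sequences bring them into the
ideal. -/
theorem IsCore.hasSeq (hP : HasInnerSequences (Set.range ((↑) : S → WithOne S)))
    {z : S} (hz : IsCore z) {I : SIdeal S} (hI : z ∈ I) {A : Set (WithOne S)} (hA : IsIdealSet A)
    (hzA : (z : WithOne S) ∉ A) : HasSeq I.toSet A := by
  obtain ⟨x, y, w, h⟩ := hz
  have hNM : NeverMerge x y w A := fun n =>
    ⟨(h n).1, fun h' => hzA (hA.mem_of_jLe (h n).2.1.2 h'),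
      fun h' => hzA (hA.mem_of_jLe (h n).2.2.2 h')⟩
  have hxz : JEq x (z : WithOne S) := (h 0).2.1
  have hyz : JEq y (z : WithOne S) := (h 0).2.2
  have hsub : ∀ m ∈ Subsemigroup.closure {x, y}, m ∈ I.toSet := fun m hm =>
    I.isIdealSet_toSet.mem_of_jLe (jLe_of_mem_closure hxz.1 hyz.1 hm) (SIdeal.coe_mem_toSet.2 hI)
  obtain ⟨x', hx', y', hy', w', hw', h'⟩ := hP x (exists_coe_eq_of_jLe hxz.1) y
    (exists_coe_eq_of_jLe hyz.1) w A hA hNM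
  exact ⟨x', hsub _ hx', y', hsub _ hy', w', fun n => (hw' n).imp_right (hsub _), h'⟩

theorem isNilp_toSub_iff [Finite S] (hP : HasInnerSequences (Set.range ((↑) : S → WithOne S)))
    (I : SIdeal S) : IsNilp I.toSub ↔ ∀ z ∈ I, ¬ IsCore z := by
  rw [← not_iff_not, not_isNilp_toSub_iff]
  push Not
  exact ⟨exists_isCore_of_hasSeq_ideal, fun ⟨z, hzI, hz⟩ =>
    hz.hasSeq hP hzI (fun _ _ _ h => h.elim) (Set.notMem_empty _)⟩

/-- The ideal of all elements that are not above a core. -/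
def coreFree (S : Type*) [Semigroup S] : SIdeal S where
  carrier := {s | ∀ z : S, IsCore z → ¬ JLe (z : WithOne S) s}
  mul_mem_left s a ha z hz h := ha z hz (h.trans (by
    rw [WithOne.coe_mul]
    exact JLe.mul_right _ _))
  mul_mem_right s a ha z hz h := ha z hz (h.trans (by
    rw [WithOne.coe_mul]
    exact JLe.mul_left _ _))

theorem coreFree_mem_nilpIdeals [Finite S]
    (hP : HasInnerSequences (Set.range ((↑) : S → WithOne S))) :
    (coreFree S : Set S) ∈ nilpIdeals S :=
  ⟨coreFree S, rfl, (isNilp_toSub_iff hP _).2 fun z hz hc => hz z hc (.refl _)⟩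

theorem K_eq_coreFree [Finite S] (hP : HasInnerSequences (Set.range ((↑) : S → WithOne S))) :
    K S = coreFree S := by
  apply Set.Subset.antisymm
  · rintro s ⟨_, ⟨I, rfl, hI⟩, hs⟩ z hz hzs
    exact (isNilp_toSub_iff hP I).1 hI z (I.mem_of_jLe hzs hs) hz
  · exact Set.subset_sUnion_of_mem (coreFree_mem_nilpIdeals hP)

theorem isGreatest_K [Finite S] (hP : HasInnerSequences (Set.range ((↑) : S → WithOne S))) :
    IsGreatest (nilpIdeals S) (K S) := by
  refine ⟨?_, fun A hA => Set.subset_sUnion_of_mem hA⟩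
  rw [K_eq_coreFree hP]
  exact coreFree_mem_nilpIdeals hP

theorem notMem_K_iff [Finite S] (hP : HasInnerSequences (Set.range ((↑) : S → WithOne S))) {s : S} :
    s ∉ K S ↔ ∃ z : S, IsMinCore z ∧ JLe (z : WithOne S) s := by
  rw [K_eq_coreFree hP]
  change ¬ (∀ z : S, IsCore z → ¬ JLe (z : WithOne S) s) ↔ _
  push Not
  constructor
  · rintro ⟨z, hz, hzs⟩
    obtain ⟨t, ht, htz⟩ := exists_isMinCore hz
    exact ⟨t, ht, htz.trans hzs⟩
  · exact fun ⟨z, hz, hzs⟩ => ⟨z, hz.1, hzs⟩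

/-- The elements above a core are closed under products, so a minimal core lies below `a s` as soon
as it lies below both factors. -/
theorem mem_KSet_iff [Finite S] (hP : HasInnerSequences (Set.range ((↑) : S → WithOne S)))
    {a s : S} : s ∈ KSet a ↔
      ∃ z : S, IsMinCore z ∧ JLe (z : WithOne S) a ∧ JLe (z : WithOne S) s := by
  change a * s ∉ K S ↔ _
  rw [notMem_K_iff hP]
  refine exists_congr fun z => and_congr_right fun hz => ?_
  rw [WithOne.coe_mul]
  exact ⟨fun h => ⟨h.trans (JLe.mul_left _ _), h.trans (JLe.mul_right _ _)⟩,
    fun h => (hz.1.closedClass hP).jLe_mul h.1 h.2⟩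

theorem adj_of_not_actsAlike [Finite S] (hP : HasInnerSequences (Set.range ((↑) : S → WithOne S)))
    {z s t : S} (hz : IsCore z) (hs : JLe (z : WithOne S) s) (ht : JLe (z : WithOne S) t)
    (hst : ¬ ActsAlike (z : WithOne S) s t) : (nonNilGraph S).Adj s t := by
  refine adj_iff.2 ⟨?_, ?_⟩
  · rintro rfl
    exact hst fun c _ => ⟨.refl _, .refl _⟩
  · exact HasSeq.mono (exists_neverMerge_of_not_actsAlike hP (hz.closedClass hP) ⟨s, rfl⟩ ⟨t, rfl⟩
      hs ht hst) subset_rfl (Set.empty_subset _)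

theorem IsCore.exists_not_actsAlike [Finite S]
    (hP : HasInnerSequences (Set.range ((↑) : S → WithOne S))) {z : S} (hz : IsCore z) :
    ∃ x y : S, JLe (z : WithOne S) x ∧ JLe (z : WithOne S) y ∧
      ¬ ActsAlike (z : WithOne S) x y := by
  obtain ⟨x, y, w, h⟩ := hz
  have hxz : JEq x (z : WithOne S) := (h 0).2.1
  have hyz : JEq y (z : WithOne S) := (h 0).2.2
  have hxy := h.not_actsAlike isIdealSet_range_coe hP ⟨z, rfl⟩
  obtain ⟨x, rfl⟩ := exists_coe_eq_of_jLe hxz.1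
  obtain ⟨y, rfl⟩ := exists_coe_eq_of_jLe hyz.1
  exact ⟨x, y, hxz.2, hyz.2, hxy⟩

/-- Fix `x`, `y` above `z` that act differently. Any element above `z` acts differently from at
least one of them, and is therefore adjacent to it. -/
theorem IsCore.reachable [Finite S] (hP : HasInnerSequences (Set.range ((↑) : S → WithOne S)))
    {z s t : S} (hz : IsCore z) (hs : JLe (z : WithOne S) s) (ht : JLe (z : WithOne S) t) :
    (nonNilGraph S).Reachable s t := by
  obtain ⟨x, y, hx, hy, hxy⟩ := hz.exists_not_actsAlike hP
  have key : ∀ r : S, JLe (z : WithOne S) r → (nonNilGraph S).Reachable r x := by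
    intro r hr
    by_cases h : ActsAlike (z : WithOne S) r x
    · have h' : ¬ ActsAlike (z : WithOne S) r y := fun h' => hxy (h.symm.trans h')
      exact (adj_of_not_actsAlike hP hz hr hy h').reachable.trans
        (adj_of_not_actsAlike hP hz hy hx fun h => hxy h.symm).reachable
    · exact (adj_of_not_actsAlike hP hz hr hx h).reachable
  exact (key s hs).trans (key t ht).symm

theorem exists_isMinCore_of_adj [Finite S] {x y : S} (h : (nonNilGraph S).Adj x y) :
    ∃ z : S, IsMinCore z ∧ JLe (z : WithOne S) x ∧ JLe (z : WithOne S) y := by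
  obtain ⟨z, hz, hzx, hzy⟩ := exists_isCore_of_hasSeq_closure (adj_iff.1 h).2
  obtain ⟨t, ht, htz⟩ := exists_isMinCore hz
  exact ⟨t, ht, htz.trans hzx, htz.trans hzy⟩

end Core

/-! ### Layers of a principal series -/

namespace PrincipalSeries

variable {S : Type*} [Semigroup S] (σ : PrincipalSeries S)

theorem ideal_subset {i j : Fin (σ.m + 1)} (h : i ≤ j) :
    (σ.ideal j : Set S) ⊆ (σ.ideal i : Set S) := by
  have : Antitone fun i => (σ.ideal i : Set S) :=
    Fin.antitone_iff_succ_le.2 fun i => (σ.ssubset i).1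
  exact this h

theorem exists_mem_layer (s : S) : ∃ i, s ∈ σ.layer i := by
  by_contra! hcon
  have : ∀ i, s ∈ σ.ideal i := by
    intro i
    induction i using Fin.induction with
    | zero =>
      have : s ∈ (σ.ideal 0 : Set S) := by rw [σ.first]; trivial
      exact this
    | succ i ih => exact not_not.1 fun h => hcon i ⟨ih, h⟩
  have h : s ∈ (σ.ideal (Fin.last σ.m) : Set S) := this _
  rw [σ.last] at h
  exact h

/-- Nonempty layers of a principal series are `𝓙`-classes. -/
theorem mem_layer_iff {i : Fin σ.m} {s t : S} (hs : s ∈ σ.layer i) :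
    t ∈ σ.layer i ↔ JEq (t : WithOne S) s := by
  constructor
  · have key : ∀ a b : S, a ∈ σ.layer i → b ∈ σ.layer i → JLe (b : WithOne S) a := by
      intro a b ha hb
      -- The ideal generated by `a` together with the lower term lies properly above that term, so
      -- it must be the whole upper term.
      let I : SIdeal S :=
        { carrier := {c | JLe (c : WithOne S) a ∨ c ∈ σ.bot i}
          mul_mem_left := fun c d hd => hd.imp
            (fun h => JLe.trans (by rw [WithOne.coe_mul]; exact JLe.mul_right _ _) h)
            ((σ.bot i).mul_mem_left c)
          mul_mem_right := fun c d hd => hd.imp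
            (fun h => JLe.trans (by rw [WithOne.coe_mul]; exact JLe.mul_left _ _) h)
            ((σ.bot i).mul_mem_right c) }
      have h1 : (σ.bot i : Set S) ⊂ (I : Set S) :=
        ⟨fun c hc => .inr hc, fun h => ha.2 (h (Or.inl (JLe.refl _)))⟩
      have h2 : (I : Set S) ⊆ (σ.top i : Set S) := by
        rintro c (hc | hc)
        · exact (σ.top i).mem_of_jLe hc ha.1
        · exact (σ.ssubset i).1 hc
      by_contra hcon
      refine σ.no_between i I ⟨h1, h2, fun h => ?_⟩
      rcases h hb.1 with h | h
      · exact hcon h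
      · exact hb.2 h
    exact fun ht => ⟨key s t hs ht, key t s ht hs⟩
  · exact fun h => ⟨(σ.top i).mem_of_jLe h.1 hs.1, fun ht => hs.2 ((σ.bot i).mem_of_jLe h.2 ht)⟩

theorem jLe_of_mem_F {i : Fin σ.m} {s z : S} (hs : s ∈ σ.F i) (hz : z ∈ σ.layer i) :
    JLe (z : WithOne S) s := by
  obtain ⟨-, q, hq, h⟩ := hs
  rcases hq with rfl | ⟨t, ht, rfl⟩
  · exfalso
    rcases h with h | h
    · exact h (congrArg (fun a : WithZero S => (a : (σ.bot i).adjoinZero.con.Quotient))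
        (mul_zero (s : WithZero S)))
    · exact h (congrArg (fun a : WithZero S => (a : (σ.bot i).adjoinZero.con.Quotient))
        (zero_mul (s : WithZero S)))
  · rw [← SIdeal.toQuotZero_mul, ← SIdeal.toQuotZero_mul, Ne, Ne, SIdeal.toQuotZero_eq_zero_iff,
      SIdeal.toQuotZero_eq_zero_iff] at h
    rcases h with h | h
    · have := ((σ.mem_layer_iff (s := s * t) ⟨(σ.top i).mul_mem_left s ht, h⟩).1 hz).1
      rw [WithOne.coe_mul] at this
      exact this.trans (JLe.mul_left _ _)
    · have := ((σ.mem_layer_iff (s := t * s) ⟨(σ.top i).mul_mem_right s ht, h⟩).1 hz).1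
      rw [WithOne.coe_mul] at this
      exact this.trans (JLe.mul_right _ _)

theorem mem_F_of_jLe {i : Fin σ.m} {s z : S} (hc : ClosedClass (z : WithOne S))
    (hz : z ∈ σ.layer i) (hzs : JLe (z : WithOne S) s) (hs : s ∉ σ.layer i) : s ∈ σ.F i := by
  have hsb : s ∉ σ.bot i := fun h => hz.2 ((σ.bot i).mem_of_jLe hzs h)
  have hst : s ∉ σ.top i := fun h => hs ⟨h, hsb⟩
  refine ⟨?_, (σ.bot i).toQuotZero z, .inr ⟨z, hz.1, rfl⟩, .inl ?_⟩
  · rintro (h | ⟨t, ht, h⟩)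
    · exact hsb (((σ.bot i).toQuotZero_eq_zero_iff s).1 h)
    · rcases ((σ.bot i).toQuotZero_eq_iff t s).1 h with rfl | h
      · exact hst ht
      · exact hsb h.2
  · rw [← SIdeal.toQuotZero_mul, Ne, SIdeal.toQuotZero_eq_zero_iff]
    intro h
    refine hz.2 ((σ.bot i).mem_of_jLe ?_ h)
    rw [WithOne.coe_mul]
    exact hc.jLe_mul hzs (.refl _)

/-- For a closed class, `Fᵢ` consists exactly of the elements above `z` outside the layer. Layers
are 𝓙-classes, so this set of elements above `z` is a union of layers, and the condition `j ≤ i` is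
automatic. -/
theorem stem_eq {i : Fin σ.m} {z : S} (hc : ClosedClass (z : WithOne S)) (hz : z ∈ σ.layer i) :
    σ.stem i = {s : S | JLe (z : WithOne S) s} := by
  have key : ∀ s, s ∈ σ.F i ∪ σ.layer i ↔ JLe (z : WithOne S) s := by
    intro s
    constructor
    · rintro (h | h)
      · exact σ.jLe_of_mem_F h hz
      · exact ((σ.mem_layer_iff hz).1 h).2
    · intro h
      by_cases hs : s ∈ σ.layer i
      · exact .inr hs
      · exact .inl (σ.mem_F_of_jLe hc hz h hs)
  ext s
  constructor
  · rintro ⟨j, -, hj, hs⟩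
    exact (key s).1 (hj hs)
  · intro hs
    obtain ⟨j, hj⟩ := σ.exists_mem_layer s
    refine ⟨j, ?_, fun t ht => (key t).2 (JLe.trans hs ((σ.mem_layer_iff hj).1 ht).2), hj⟩
    by_contra! hij
    have h1 : s ∈ σ.bot i := σ.ideal_subset (Fin.succ_le_castSucc_iff.2 hij) hj.1
    exact hz.2 ((σ.bot i).mem_of_jLe hs h1)

/-- An edge from the layer to a lower element `b` would have a minimal core below both ends. By
minimality of `z` that core lies above `z`, so `z` would be below `b`. -/
theorem isRoot_of_isMinCore [Finite S] (hP : HasInnerSequences (Set.range ((↑) : S → WithOne S)))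
    {i : Fin σ.m} {z : S} (hz : IsMinCore z) (hzi : z ∈ σ.layer i) : σ.IsRoot i := by
  refine ⟨(σ.not_factorNilp_iff i).2 (hz.1.hasSeq hP hzi.1 (σ.bot i).isIdealSet_toSet
    fun h => hzi.2 (SIdeal.coe_mem_toSet.1 h)), fun a ha b hb hab => ?_⟩
  obtain ⟨t, ht, hta, htb⟩ := exists_isMinCore_of_adj hab
  have := hz.2 t ht.1 (hta.trans ((σ.mem_layer_iff hzi).1 ha).1)
  exact hzi.2 ((σ.bot i).mem_of_jLe (this.trans htb) hb)

/-- This turns the graph-theoretic definition of `Φᵢ` into a statement about the action on the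
layer. -/
theorem adj_toQuotZero_iff_not_actsAlike [Finite S]
    (hP : HasInnerSequences (Set.range ((↑) : S → WithOne S))) {i : Fin σ.m} {z s y : S}
    (hz : IsCore z) (hzi : z ∈ σ.layer i) (hs : JLe (z : WithOne S) s) (hy : y ∈ σ.layer i) :
    (nonNilGraph (σ.bot i).QuotZero).Adj ((σ.bot i).toQuotZero s) ((σ.bot i).toQuotZero y) ↔
      ¬ ActsAlike (z : WithOne S) s y := by
  have hyz := (σ.mem_layer_iff hzi).1 hy
  rw [adj_toQuotZero_iff]
  constructor
  · rintro ⟨-, x', hx', y', hy', w, hw, h⟩ hsy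
    exact not_neverMerge_of_actsAlike isIdealSet_range_coe hP (σ.bot i).isIdealSet_toSet
      (hz.closedClass hP) ⟨z, rfl⟩ hs hyz hsy hx' hy' hw h
  · intro hsy
    refine ⟨fun h => ?_, HasSeq.mono (exists_neverMerge_of_not_actsAlike hP (hz.closedClass hP)
      ⟨s, rfl⟩ ⟨y, rfl⟩ hs hyz.2 hsy) subset_rfl fun m hm hzm => ?_⟩
    · rcases ((σ.bot i).toQuotZero_eq_iff s y).1 h with rfl | h
      · exact hsy fun c _ => ⟨.refl _, .refl _⟩
      · exact hy.2 h.2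
    · exact hzi.2 (SIdeal.coe_mem_toSet.1 ((σ.bot i).isIdealSet_toSet.mem_of_jLe hzm hm))

end PrincipalSeries

/-! ### Pseudo-nilpotent classes -/

/-- The value of `Φ` is chosen from a predicate that depends only on adjacency to the nonzero
elements of `J`. Equal predicates give equal choices, so uniqueness of the pair is not needed. -/
theorem ReesCoordinates.Φ_eq_Φ {S : Type*} [Mul S] [Zero S] {J : Set S} (c : ReesCoordinates S J)
    {a b : S} (ha : a ∈ FSet J ∪ (J \ {0})) (hb : b ∈ FSet J ∪ (J \ {0}))
    (h : ∀ g i l, (nonNilGraph S).Adj a (c.φ (.elt g i l)) ↔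
      (nonNilGraph S).Adj b (c.φ (.elt g i l))) : c.Φ a = c.Φ b := by
  have hpred : (fun p : c.I × c.Λ => ∀ g : c.G, ¬ (nonNilGraph S).Adj a (c.φ (.elt g p.1 p.2))) =
      fun p => ∀ g : c.G, ¬ (nonNilGraph S).Adj b (c.φ (.elt g p.1 p.2)) := by
    funext p
    simp only [h]
  have hchoose : ∀ (P Q : c.I × c.Λ → Prop) (hP : ∃ p, P p) (hQ : ∃ p, Q p), P = Q →
      hP.choose = hQ.choose := by
    rintro P _ _ _ rfl
    rfl
  unfold ReesCoordinates.Φ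
  by_cases hex : ∃ p : c.I × c.Λ, ∀ g : c.G, ¬ (nonNilGraph S).Adj a (c.φ (.elt g p.1 p.2))
  · have hex' : ∃ p : c.I × c.Λ, ∀ g : c.G, ¬ (nonNilGraph S).Adj b (c.φ (.elt g p.1 p.2)) := by
      obtain ⟨p, hp⟩ := hex
      exact ⟨p, by simpa only [h] using hp⟩
    rw [dif_pos ⟨ha, hex⟩, dif_pos ⟨hb, hex'⟩]
    exact congrArg some (hchoose _ _ _ _ hpred)
  · have hex' : ¬ ∃ p : c.I × c.Λ, ∀ g : c.G, ¬ (nonNilGraph S).Adj b (c.φ (.elt g p.1 p.2)) := by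
      simpa only [h] using hex
    rw [dif_neg fun h => hex h.2, dif_neg fun h => hex' h.2]

theorem ReesCoordinates.φ_elt_ne_zero {S : Type*} [Semigroup S] {I : SIdeal S}
    {J : Set I.QuotZero} (c : ReesCoordinates I.QuotZero J) (h0 : 0 ∈ J) (g : c.G) (i : c.I)
    (l : c.Λ) : c.φ (.elt g i l) ≠ 0 := by
  have hzero : c.φ .zero = 0 := by
    rw [← c.range_eq] at h0
    obtain ⟨q, hq⟩ := h0
    let _ := c.group
    have h1 : c.φ ((.zero : ReesMatrixZero c.P) * q) = c.φ .zero * 0 := by rw [map_mul, hq]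
    have h2 : c.φ .zero * 0 = 0 := by
      obtain ⟨r, hr⟩ := Quotient.exists_rep (c.φ .zero)
      rw [← hr]
      exact congrArg (fun a : WithZero S => (a : I.adjoinZero.con.Quotient)) (mul_zero r)
    exact h1.trans h2
  rw [← hzero]
  intro h
  have := c.injective h
  contradiction

theorem PrincipalSeries.MeetsTwoClasses.exists_not_actsAlike {S : Type*} [Semigroup S] [Finite S]
    {σ : PrincipalSeries S} (hP : HasInnerSequences (Set.range ((↑) : S → WithOne S)))
    {i : Fin σ.m} {z : S} {D : Set S} (hz : IsCore z) (hzi : z ∈ σ.layer i)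
    (hD : ∀ d ∈ D, JLe (z : WithOne S) d) (h : σ.MeetsTwoClasses i D) :
    ∃ a ∈ D, ∃ b ∈ D, ¬ ActsAlike (z : WithOne S) a b := by
  obtain ⟨c, a, ha, b, hb, hne⟩ := h
  refine ⟨a, ha, b, hb, fun hab => hne ?_⟩
  have hmem : ∀ d ∈ D, (σ.bot i).toQuotZero d ∈
      FSet (σ.factorIdeal i) ∪ (σ.factorIdeal i \ {0}) := by
    intro d hd
    by_cases hdi : d ∈ σ.layer i
    · refine .inr ⟨.inr ⟨d, hdi.1, rfl⟩, fun h => hdi.2 ?_⟩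
      exact ((σ.bot i).toQuotZero_eq_zero_iff d).1 h
    · exact .inl (σ.mem_F_of_jLe (hz.closedClass hP) hzi (hD d hd) hdi)
  refine c.Φ_eq_Φ (hmem a ha) (hmem b hb) fun g e f => ?_
  have h0 := c.φ_elt_ne_zero (.inl rfl) g e f
  have hJ : c.φ (.elt g e f) ∈ σ.factorIdeal i :=
    c.range_eq.subset ⟨_, rfl⟩
  rcases hJ with hJ | ⟨y, hy, hJ⟩
  · exact absurd hJ h0
  · have hyi : y ∈ σ.layer i := ⟨hy, fun h => h0 (by
      rw [← hJ]
      exact ((σ.bot i).toQuotZero_eq_zero_iff y).2 h)⟩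
    rw [← hJ, σ.adj_toQuotZero_iff_not_actsAlike hP hz hzi (hD a ha) hyi,
      σ.adj_toQuotZero_iff_not_actsAlike hP hz hzi (hD b hb) hyi]
    exact not_congr ⟨fun h => hab.symm.trans h, fun h => hab.trans h⟩

/-! ### Connected components -/

section Components

variable {S : Type*} [Semigroup S]

/-- The elements of the minimal cores below `a`. -/
def coresBelow (a : S) : Set S := {z | IsMinCore z ∧ JLe (z : WithOne S) a}

/-- If `a` has a maximal set of minimal cores, then `K_a` is closed under adjacency. -/
theorem PrincipalSeries.IsStrongPseudoNilpotent.mem_KSet_of_adj [Finite S] {σ : PrincipalSeries S}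
    (hS : σ.IsStrongPseudoNilpotent) {a x y : S}
    (hmax : ∀ b, coresBelow a ⊆ coresBelow b → coresBelow b ⊆ coresBelow a)
    (hx : x ∈ KSet a) (hxy : (nonNilGraph S).Adj x y) : y ∈ KSet a := by
  have hP := hS.1.hasInnerSequences
  rw [mem_KSet_iff hP] at hx ⊢
  obtain ⟨k, hk, hka, hkx⟩ := hx
  obtain ⟨l, hl, hlx, hly⟩ := exists_isMinCore_of_adj hxy
  by_cases hla : JLe (l : WithOne S) a
  · exact ⟨l, hl, hla, hly⟩
  exfalso
  obtain ⟨ik, hik⟩ := σ.exists_mem_layer k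
  obtain ⟨il, hil⟩ := σ.exists_mem_layer l
  obtain ⟨j, hj⟩ := σ.exists_mem_layer x
  obtain ⟨i, hi⟩ := σ.exists_mem_layer a
  have hjx : ∀ d ∈ σ.layer j, JLe (x : WithOne S) d := fun d hd => ((σ.mem_layer_iff hj).1 hd).2
  -- The stems are the sets of elements above `k` and above `l`; they differ because `a` lies only
  -- in the first.
  have hconn : σ.IsConnection j ik il := by
    refine ⟨σ.isRoot_of_isMinCore hP hk hik, σ.isRoot_of_isMinCore hP hl hil, ?_, ?_⟩
    · rw [σ.stem_eq (hk.1.closedClass hP) hik, σ.stem_eq (hl.1.closedClass hP) hil]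
      intro h
      exact hla (h.subset hka)
    · rw [σ.stem_eq (hk.1.closedClass hP) hik, σ.stem_eq (hl.1.closedClass hP) hil]
      exact fun d hd => ⟨hkx.trans (hjx d hd), hlx.trans (hjx d hd)⟩
  obtain ⟨p, hp, q, hq, hpq⟩ := (hS.2.1 j ik il hconn).1.exists_not_actsAlike hP hk.1 hik
    (fun d hd => hkx.trans (hjx d hd))
  -- By (H1) two elements of the layer of `x` act differently on `k`, and `a` cannot act like both.
  obtain ⟨d, hd, hda⟩ : ∃ d ∈ σ.layer j, (nonNilGraph S).Adj d a := by
    by_cases h : ActsAlike (k : WithOne S) p a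
    · exact ⟨q, hq, adj_of_not_actsAlike hP hk.1 (hkx.trans (hjx q hq)) hka
        fun h' => hpq (h.trans h'.symm)⟩
    · exact ⟨p, hp, adj_of_not_actsAlike hP hk.1 (hkx.trans (hjx p hp)) hka h⟩
  -- Now (H2) applies. If `a` is below `x`, maximality of the cores of `a` already puts `l` below
  -- `a`; otherwise `x` is below `a`, and `l` with it.
  rcases lt_trichotomy j i with h | rfl | h
  · have had := σ.jLe_of_mem_F (hS.2.2 j i h ⟨d, hd, a, hi, hda⟩ hj) hi
    exact hla (hmax x (fun z hz => ⟨hz.1, hz.2.trans had⟩) ⟨hl, hlx⟩).2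
  · exact hla (hlx.trans (hjx a hi))
  · have hxa := σ.jLe_of_mem_F (hS.2.2 i j h ⟨a, hi, d, hd, hda.symm⟩ hi) hj
    exact hla (hlx.trans hxa)

theorem PrincipalSeries.IsStrongPseudoNilpotent.exists_supp_eq_KSet [Finite S]
    {σ : PrincipalSeries S} (hS : σ.IsStrongPseudoNilpotent) {a : S} (ha : a ∉ K S)
    (hmax : ∀ b, coresBelow a ⊆ coresBelow b → coresBelow b ⊆ coresBelow a) :
    (KSet a).Nontrivial ∧ ∃ c : (nonNilGraph S).ConnectedComponent, c.supp = KSet a := by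
  have hP := hS.1.hasInnerSequences
  obtain ⟨z, hz, hza⟩ := (notMem_K_iff hP).1 ha
  constructor
  · obtain ⟨x, y, hx, hy, hxy⟩ := hz.1.exists_not_actsAlike hP
    refine ⟨x, (mem_KSet_iff hP).2 ⟨z, hz, hza, hx⟩, y, (mem_KSet_iff hP).2 ⟨z, hz, hza, hy⟩, ?_⟩
    rintro rfl
    exact hxy fun c _ => ⟨.refl _, .refl _⟩
  · refine ⟨(nonNilGraph S).connectedComponentMk a, ?_⟩
    ext s
    rw [SimpleGraph.ConnectedComponent.mem_supp_iff, SimpleGraph.ConnectedComponent.eq]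
    constructor
    · intro h
      have walk : ∀ u v : S, (nonNilGraph S).Walk u v → u ∈ KSet a → v ∈ KSet a := by
        intro u v p
        induction p with
        | nil => exact id
        | cons h _ ih => exact fun hu => ih (hS.mem_KSet_of_adj hmax hu h)
      obtain ⟨p⟩ := h.symm
      exact walk _ _ p ((mem_KSet_iff hP).2 ⟨z, hz, hza, hza⟩)
    · intro h
      obtain ⟨t, ht, hta, hts⟩ := (mem_KSet_iff hP).1 h
      exact ht.1.reachable hP hts hta

theorem exists_maximal_coresBelow [Finite S] (a : S) : ∃ b, coresBelow a ⊆ coresBelow b ∧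
    ∀ c, coresBelow b ⊆ coresBelow c → coresBelow c ⊆ coresBelow b := by
  obtain ⟨b, hb, hmax⟩ := Set.Finite.exists_maximalFor (fun b : S => coresBelow b)
    {b : S | coresBelow a ⊆ coresBelow b} (Set.toFinite _) ⟨a, Set.Subset.refl _⟩
  exact ⟨b, hb, fun c hc => hmax (subset_trans hb hc) hc⟩

theorem KSet_subset_KSet [Finite S] (hP : HasInnerSequences (Set.range ((↑) : S → WithOne S)))
    {a b : S} (h : coresBelow a ⊆ coresBelow b) : KSet a ⊆ KSet b := by
  intro s hs
  rw [mem_KSet_iff hP] at hs ⊢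
  obtain ⟨z, hz, hza, hzs⟩ := hs
  exact ⟨z, hz, (h ⟨hz, hza⟩).2, hzs⟩

end Components

end PseudoNilpotent

/-! ### Components as the maximal sets `K_a` -/

theorem mainTheorem11 {S : Type u} [Semigroup S] [Finite S]
    (σ : PseudoNilpotent.PrincipalSeries S) (hS : σ.IsStrongPseudoNilpotent) :
    IsGreatest (PseudoNilpotent.nilpIdeals S) (PseudoNilpotent.K S) ∧
    {C : Set S | C.Nontrivial ∧
        ∃ c : (PseudoNilpotent.nonNilGraph S).ConnectedComponent, c.supp = C} =
      {C : Set S | Maximal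
        (fun A : Set S => ∃ a : S, a ∉ PseudoNilpotent.K S ∧ A = PseudoNilpotent.KSet a) C} := by
  have hP := hS.1.hasInnerSequences
  refine ⟨PseudoNilpotent.isGreatest_K hP, ?_⟩
  have notMem_K : ∀ {a b : S}, a ∉ PseudoNilpotent.K S →
      PseudoNilpotent.coresBelow a ⊆ PseudoNilpotent.coresBelow b →
      b ∉ PseudoNilpotent.K S := by
    intro a b ha hab
    obtain ⟨z, hz, hza⟩ := (PseudoNilpotent.notMem_K_iff hP).1 ha
    exact (PseudoNilpotent.notMem_K_iff hP).2 ⟨z, hz, (hab ⟨hz, hza⟩).2⟩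
  ext C
  constructor
  · rintro ⟨hnt, c, rfl⟩
    obtain ⟨x, hx, y, hy, hne⟩ := hnt
    obtain ⟨p⟩ := SimpleGraph.ConnectedComponent.exact (hx.trans hy.symm)
    obtain ⟨v, hxv⟩ : ∃ v, (PseudoNilpotent.nonNilGraph S).Adj x v := by
      cases p with
      | nil => exact absurd rfl hne
      | cons h _ => exact ⟨_, h⟩
    obtain ⟨z, hz, hzx, -⟩ := PseudoNilpotent.exists_isMinCore_of_adj hxv
    obtain ⟨a, hxa, hmax⟩ := PseudoNilpotent.exists_maximal_coresBelow x
    have ha : a ∉ PseudoNilpotent.K S :=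
      notMem_K ((PseudoNilpotent.notMem_K_iff hP).2 ⟨z, hz, hzx⟩) hxa
    obtain ⟨-, d, hd⟩ := hS.exists_supp_eq_KSet ha hmax
    have hxd : x ∈ d.supp := by
      rw [hd]
      exact (PseudoNilpotent.mem_KSet_iff hP).2 ⟨z, hz, (hxa ⟨hz, hzx⟩).2, hzx⟩
    obtain rfl : c = d := hx.symm.trans hxd
    refine ⟨⟨a, ha, hd⟩, ?_⟩
    rintro _ ⟨b, hb, rfl⟩ hle
    -- Any larger `K_b` lies in some `K_{b'}` that is itself a component. That component contains
    -- `x`, so it is the given one.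
    obtain ⟨b', hbb', hmax'⟩ := PseudoNilpotent.exists_maximal_coresBelow b
    obtain ⟨-, e, he⟩ := hS.exists_supp_eq_KSet (notMem_K hb hbb') hmax'
    have hbe : PseudoNilpotent.KSet b ⊆ e.supp := by
      rw [he]
      exact PseudoNilpotent.KSet_subset_KSet hP hbb'
    obtain rfl : c = e := hx.symm.trans (hbe (hle hx))
    exact hbe
  · rintro ⟨⟨a, ha, rfl⟩, hCmax⟩
    obtain ⟨b, hab, hmax⟩ := PseudoNilpotent.exists_maximal_coresBelow a
    have hb := notMem_K ha hab
    have hsub := PseudoNilpotent.KSet_subset_KSet hP hab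
    -- A maximal `K_a` equals `K_b` for some `b` with a maximal set of minimal cores, and such a
    -- `K_b` is a component.
    have heq : PseudoNilpotent.KSet a = PseudoNilpotent.KSet b :=
      hsub.antisymm (hCmax ⟨b, hb, rfl⟩ hsub)
    rw [heq]
    exact hS.exists_supp_eq_KSet hb hmax
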